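/- Let $V$ be a finite-dimensional real vector space with a symmetric bilinear form $\ell$ of signature $(+,-,\dots,-)$, and let $C$ be one of the two closed convex cones whose union is $\{v:\ell(v,v)\ge 0\}$. Let $\Gamma$ be a group of affine transformations $\gamma(v)=\lambda(\gamma)v+\tau(\gamma)$ of $V$ whose linear parts $\lambda(\gamma)$ preserve $\ell$ and $C$, acting freely and properly on $V$; let $\kappa:V\to M=V/\Gamma$ be the quotient map. The future and past of $p=\kappa(v)$ are $F_p=\kappa(v+C)$ and $P_p=\kappa(v-C)$. $M$ is called causal if it has no nonconstant closed piecewise smooth path $\eta$ with $\eta'(t)\in C_{\eta(t)}$ for all $t$, where $C_{\kappa(v)}=d_v\kappa(C)$; it is called strictly causal if it is causal and each $p\in M$ has a neighbourhood $U$ such that $U\cap F_p$ and $U\cap P_p$ are closed in $U$. $M$ is called unipotent if all $\lambda(\gamma)$, $\gamma\in\Gamma$, are unipotent. Consider the following two types of groups; a uniform lattice in a vector space is a discrete subgroup that spans it, and a subspace $X$ is spacelike if $X\cap C=\{0\}$. (i) $V=T\oplus L$ is an $\ell$-orthogonal decomposition into linear subspaces, $T$ is spacelike, $\dim L=1$ and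 $L\cap\operatorname{Int}C\ne\emptyset$; $\Gamma$ is a uniform lattice in $T$, acting on $V$ by translations. (ii) $v_0,v_1\in\partial C$ satisfy $\ell(v_0,v_1)=1$; $N=v_0^\perp\cap v_1^\perp$; $l_0(v)=\ell(v,v_0)$; for $x\in N$, $$\nu(x)v=v+l_0(v)x-\Bigl(\ell(v,x)+\tfrac12\,l_0(v)\ell(x,x)\Bigr)v_0 .$$ $T\subseteq N$ is a linear subspace, $\Gamma$ is a uniform lattice in $T$, $a:T\to N$ is a linear map with $\ell(ax,y)=\ell(x,ay)$ for $x,y\in T$, and $x\in\Gamma$ acts on $V$ by $$\gamma_x(v)=\nu(ax)v+x-\tfrac12\,\ell(ax,x)v_0 .$$ Theorem. (1) If $M$ is strictly causal and unipotent, then it is finitely covered by some $V/\Gamma'$, where $\Gamma'\subseteq\Gamma$ is of type (i), or of type (ii) with $$\ker(\mathbf 1+ta)=0\quad\text{for all } t\in\mathbb R, \tag{$*$}$$ where $\mathbf 1$ denotes the inclusion $T\to N$. (2) Conversely, if $\Gamma$ is as in (i), or as in (ii) with $(*)$, then the action of $\Gamma$ is free and proper with linear parts preserving $\ell$ and $C$,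 and $V/\Gamma$ is strictly causal. (3) In both cases of (2), $V/\Gamma$ is homeomorphic to the product of the torus $T/\Gamma$ and the vector space $V/T$. -/

import Mathlib

open scoped ContDiff Topology

/-- Affine transformations of `V` act on `V` by evaluation. -/
instance affineEquivMulAction {V : Type*} [AddCommGroup V] [Module ℝ V] :
    MulAction (V ≃ᵃ[ℝ] V) V where
  smul γ v := γ v
  one_smul _ := rfl
  mul_smul _ _ _ := rfl

/-- A Minkowski structure on a real vector space `V`: a symmetric bilinear form `ℓ` of signature
`(+,-,…,-)`, together with the choice `C` of one of the two closed convex cones whose union is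
`{v | 0 ≤ ℓ(v,v)}` (the one that contains a given timelike vector `e`). -/
structure Minkowski (V : Type*) [AddCommGroup V] [Module ℝ V] where
  /-- The Lorentzian form `ℓ`. -/
  form : LinearMap.BilinForm ℝ V
  symm : ∀ v w, form v w = form w v
  lorentzian : ∃ e, 0 < form e e ∧ ∀ v, form e v = 0 → v ≠ 0 → form v v < 0
  /-- The cone `C`. -/
  cone : Set V
  cone_eq : ∃ e, 0 < form e e ∧ cone = {v | 0 ≤ form v v ∧ 0 ≤ form e v}

/-- The quotient space `V/Γ` with the quotient topology. -/
abbrev FlatQuotient {V : Type*} [AddCommGroup V] [Module ℝ V]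
    (Γ : Subgroup (V ≃ᵃ[ℝ] V)) : Type _ :=
  MulAction.orbitRel.Quotient Γ V

/-- The quotient mapping `κ : V → V/Γ`. -/
def FlatQuotient.proj {V : Type*} [AddCommGroup V] [Module ℝ V]
    (Γ : Subgroup (V ≃ᵃ[ℝ] V)) (v : V) : FlatQuotient Γ :=
  Quotient.mk (MulAction.orbitRel Γ V) v

/-- The natural map `V/Γ' → V/Γ` for `Γ' ≤ Γ`. -/
def FlatQuotient.map {V : Type*} [AddCommGroup V] [Module ℝ V]
    {Γ' Γ : Subgroup (V ≃ᵃ[ℝ] V)} (h : Γ' ≤ Γ) : FlatQuotient Γ' → FlatQuotient Γ :=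
  Quotient.map id (by
    rintro v w ⟨γ, hγ⟩
    exact ⟨⟨γ.1, h γ.2⟩, hγ⟩)

/-- `V/Γ' → V/Γ` is a finite covering. (It is automatically a local isometry that respects the
cone fields, since both are induced from `V`.) -/
def IsFiniteCover {V : Type*} [NormedAddCommGroup V] [NormedSpace ℝ V]
    (Γ' Γ : Subgroup (V ≃ᵃ[ℝ] V)) : Prop :=
  ∃ h : Γ' ≤ Γ, IsCoveringMap (FlatQuotient.map h) ∧
    ∀ p, (FlatQuotient.map h ⁻¹' {p}).Finite

/-- A uniform lattice in a finite-dimensional real vector space: a discrete subgroup that spans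
the space. -/
structure IsUniformLattice {E : Type*} [NormedAddCommGroup E] [NormedSpace ℝ E]
    (Λ : AddSubgroup E) : Prop where
  discrete : DiscreteTopology Λ
  span_eq_top : Submodule.span ℝ (Λ : Set E) = ⊤

namespace Minkowski

section Causality

variable {V : Type*} [NormedAddCommGroup V] [NormedSpace ℝ V]

/-- The groups `Γ` whose quotients `V/Γ` are the complete flat Lorentzian manifolds with a cone
field: `Γ` acts on `V` by affine transformations with linear parts preserving `ℓ` and `C`, and the
action is free and proper. -/
structure IsFlatGroup (M : Minkowski V) (Γ : Subgroup (V ≃ᵃ[ℝ] V)) : Prop where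
  form_eq : ∀ γ ∈ Γ, ∀ v w, M.form (γ.linear v) (γ.linear w) = M.form v w
  cone_eq : ∀ γ ∈ Γ, γ.linear '' M.cone = M.cone
  free : ∀ γ ∈ Γ, ∀ v, γ v = v → γ = 1
  proper : ProperlyDiscontinuousSMul Γ V

/-- `Γ` is unipotent: all linear parts are unipotent. -/
def IsUnipotent (Γ : Subgroup (V ≃ᵃ[ℝ] V)) : Prop :=
  ∀ γ ∈ Γ, IsNilpotent ((γ.linear.toLinearMap : Module.End ℝ V) - 1)

/-- The future `F_p = κ(v + C)`, `κ(v) = p`. -/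
def future (M : Minkowski V) (Γ : Subgroup (V ≃ᵃ[ℝ] V)) (p : FlatQuotient Γ) :
    Set (FlatQuotient Γ) :=
  {q | ∃ v, FlatQuotient.proj Γ v = p ∧ ∃ c ∈ M.cone, q = FlatQuotient.proj Γ (v + c)}

/-- The past `P_p = κ(v - C)`, `κ(v) = p`. -/
def past (M : Minkowski V) (Γ : Subgroup (V ≃ᵃ[ℝ] V)) (p : FlatQuotient Γ) :
    Set (FlatQuotient Γ) :=
  {q | ∃ v, FlatQuotient.proj Γ v = p ∧ ∃ c ∈ M.cone, q = FlatQuotient.proj Γ (v - c)}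

/-- Piecewise smooth timelike (in the wide sense, `η'(t) ∈ C_{η(t)}`) paths in `V/Γ`. The smooth
structure and the cone field of `V/Γ` are those for which `κ` is a local diffeomorphism carrying
the constant field `C` to the field `C_p`; as a partition may be refined until each piece lies in
an evenly covered set, the pieces are written as `κ ∘ c` with `c` smooth. -/
def IsTimelikePath (M : Minkowski V) (Γ : Subgroup (V ≃ᵃ[ℝ] V)) {p q : FlatQuotient Γ}
    (η : Path p q) : Prop :=
  ∃ (k : ℕ) (t : Fin (k + 1) → ℝ), StrictMono t ∧ t 0 = 0 ∧ t (Fin.last k) = 1 ∧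
    ∀ i : Fin k, ∃ c : ℝ → V,
      ContDiffOn ℝ ∞ c (Set.Icc (t i.castSucc) (t i.succ)) ∧
      ∀ s ∈ Set.Icc (t i.castSucc) (t i.succ),
        η.extend s = FlatQuotient.proj Γ (c s) ∧
        derivWithin c (Set.Icc (t i.castSucc) (t i.succ)) s ∈ M.cone

/-- `V/Γ` is causal: it has no (nonconstant) closed piecewise smooth timelike path. -/
def IsCausal (M : Minkowski V) (Γ : Subgroup (V ≃ᵃ[ℝ] V)) : Prop :=
  ∀ (p : FlatQuotient Γ) (η : Path p p), M.IsTimelikePath Γ η → ∀ s, η s = p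

/-- `V/Γ` is strictly causal: it is causal, and each point `p` has a neighbourhood `U` such that
`U ∩ F_p` and `U ∩ P_p` are closed in `U`. -/
def IsStrictlyCausal (M : Minkowski V) (Γ : Subgroup (V ≃ᵃ[ℝ] V)) : Prop :=
  M.IsCausal Γ ∧ ∀ p : FlatQuotient Γ, ∃ U ∈ 𝓝 p,
    IsClosed ((↑) ⁻¹' M.future Γ p : Set U) ∧ IsClosed ((↑) ⁻¹' M.past Γ p : Set U)

end Causality

section TypeI

variable {V : Type*} [NormedAddCommGroup V] [NormedSpace ℝ V]

/-- Data for the groups of the first type: an orthogonal decomposition `V = T ⊕ L` with `T`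
spacelike and `L` a line meeting `Int C`, and a uniform lattice `Λ` in `T`. -/
structure EllipticData (M : Minkowski V) where
  T : Submodule ℝ V
  L : Submodule ℝ V
  isCompl : IsCompl T L
  orthogonal : ∀ x ∈ T, ∀ y ∈ L, M.form x y = 0
  spacelike : (T : Set V) ∩ M.cone = {0}
  finrank_L : Module.finrank ℝ L = 1
  timelike_L : ((L : Set V) ∩ interior M.cone).Nonempty
  Λ : AddSubgroup T
  lattice : IsUniformLattice Λ

/-- The group of translations of `V` by the vectors of `Λ`. -/
def EllipticData.group {M : Minkowski V} (D : M.EllipticData) : Subgroup (V ≃ᵃ[ℝ] V) :=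
  (AddSubgroup.toSubgroup (D.Λ.map D.T.subtype.toAddMonoidHom)).map (AffineEquiv.constVAddHom ℝ V)

end TypeI

section TypeII

/-- The linear transformation `ν(x)v = v + l₀(v)x - (ℓ(v,x) + ½ l₀(v)ℓ(x,x))v₀`, where
`l₀(v) = ℓ(v,v₀)`. -/
noncomputable def nu {V : Type*} [AddCommGroup V] [Module ℝ V] (M : Minkowski V) (v₀ x : V) : V →ₗ[ℝ] V where
  toFun v := v + M.form v v₀ • x -
    (M.form v x + 1 / 2 * M.form v v₀ * M.form x x) • v₀
  map_add' v w := by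
    simp only [map_add, LinearMap.add_apply]
    module
  map_smul' r v := by
    simp only [map_smul, LinearMap.smul_apply, smul_eq_mul, RingHom.id_apply]
    module

/-- `N = v₀^⊥ ∩ v₁^⊥`. -/
def transverse {V : Type*} [AddCommGroup V] [Module ℝ V] (M : Minkowski V) (v₀ v₁ : V) :
    Submodule ℝ V :=
  LinearMap.ker (M.form v₀) ⊓ LinearMap.ker (M.form v₁)

variable {V : Type*} [NormedAddCommGroup V] [NormedSpace ℝ V]

/-- Data for the groups of the second type: `v₀, v₁ ∈ ∂C` with `ℓ(v₀,v₁) = 1`, a subspace `T` of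
`N = v₀^⊥ ∩ v₁^⊥`, a uniform lattice `Λ` in `T`, and an `ℓ`-symmetric linear map `a : T → N`. -/
structure ParabolicData (M : Minkowski V) where
  v₀ : V
  v₁ : V
  v₀_mem : v₀ ∈ frontier M.cone
  v₁_mem : v₁ ∈ frontier M.cone
  form_v₀_v₁ : M.form v₀ v₁ = 1
  T : Submodule ℝ V
  T_le : T ≤ M.transverse v₀ v₁
  Λ : AddSubgroup T
  lattice : IsUniformLattice Λ
  a : T →ₗ[ℝ] M.transverse v₀ v₁
  a_symm : ∀ x y : T, M.form (a x : V) (y : V) = M.form (x : V) (a y : V)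

/-- A vector of the boundary of `C` is isotropic. -/
theorem form_self_of_mem_frontier [FiniteDimensional ℝ V] (M : Minkowski V) {v : V}
    (hv : v ∈ frontier M.cone) : M.form v v = 0 := by
  obtain ⟨e, he, hC⟩ := M.cone_eq
  obtain ⟨f, hf, hneg⟩ := M.lorentzian
  have hq : Continuous fun w : V => M.form w w := by
    have h1 : Continuous fun w : V => LinearMap.toContinuousLinearMap (M.form w) :=
      (LinearMap.continuous_of_finiteDimensional
        (LinearMap.toContinuousLinearMap.toLinearMap ∘ₗ M.form))
    exact h1.clm_apply continuous_id
  have hl : Continuous fun w : V => M.form e w := LinearMap.continuous_of_finiteDimensional _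
  have hclosed : IsClosed M.cone := by
    rw [hC]
    exact (isClosed_le continuous_const hq).inter (isClosed_le continuous_const hl)
  have hvC : v ∈ M.cone := hclosed.frontier_subset hv
  have hvC' := hvC
  rw [hC] at hvC'
  obtain ⟨h0, h1⟩ := hvC'
  by_contra hne
  have hpos : 0 < M.form v v := lt_of_le_of_ne h0 (Ne.symm hne)
  have hev : M.form e v ≠ 0 := by
    intro hev
    have hve : M.form v e = 0 := by rw [M.symm]; exact hev
    set w : V := M.form f v • e - M.form f e • v with hw
    have hfw : M.form f w = 0 := by
      simp only [hw, map_sub, map_smul, smul_eq_mul]; ring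
    have hww : M.form w w = M.form f v ^ 2 * M.form e e + M.form f e ^ 2 * M.form v v := by
      simp only [hw, map_sub, map_smul, LinearMap.sub_apply, LinearMap.smul_apply, smul_eq_mul,
        hev, hve]
      ring
    have hw0 : w = 0 := by
      by_contra hw0
      have := hneg w hfw hw0
      rw [hww] at this
      nlinarith [mul_nonneg (sq_nonneg (M.form f v)) he.le,
        mul_nonneg (sq_nonneg (M.form f e)) hpos.le]
    have hzero : M.form f v ^ 2 * M.form e e + M.form f e ^ 2 * M.form v v = 0 := by
      rw [← hww, hw0]; simp
    have hfv : M.form f v = 0 := by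
      have h2 : M.form f v ^ 2 * M.form e e = 0 := by
        nlinarith [mul_nonneg (sq_nonneg (M.form f v)) he.le,
          mul_nonneg (sq_nonneg (M.form f e)) hpos.le]
      rcases mul_eq_zero.mp h2 with h3 | h3
      · exact pow_eq_zero_iff (two_ne_zero) |>.mp h3
      · exact absurd h3 he.ne'
    have hv0 : v ≠ 0 := by
      rintro rfl
      simp at hpos
    exact absurd (hneg v hfv hv0) (not_lt.mpr h0)
  have hev' : 0 < M.form e v := lt_of_le_of_ne h1 (Ne.symm hev)
  have hint : v ∈ interior M.cone := by
    rw [mem_interior]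
    refine ⟨{w | 0 < M.form w w} ∩ {w | 0 < M.form e w}, ?_,
      (isOpen_lt continuous_const hq).inter (isOpen_lt continuous_const hl), hpos, hev'⟩
    rw [hC]
    exact fun w hw => ⟨hw.1.le, hw.2.le⟩
  exact hv.2 hint

namespace ParabolicData

variable {M : Minkowski V}

/-- `λ(x) = ν(ax)`. -/
noncomputable def lam (D : M.ParabolicData) (x : D.T) : V →ₗ[ℝ] V := M.nu D.v₀ (D.a x)

/-- `τ(x) = x - ½ ℓ(ax,x) v₀`. -/
noncomputable def tau (D : M.ParabolicData) (x : D.T) : V :=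
  (x : V) - (1 / 2 * M.form (D.a x : V) (x : V)) • D.v₀

/-- The condition `ker (1 + ta) = 0` for all real `t`. -/
def KerTrivial (D : M.ParabolicData) : Prop :=
  ∀ t : ℝ, LinearMap.ker (Submodule.inclusion D.T_le + t • D.a) = ⊥

theorem lam_zero_apply (D : M.ParabolicData) (v : V) : D.lam 0 v = v := by
  simp [lam, nu]

theorem tau_zero (D : M.ParabolicData) : D.tau 0 = 0 := by
  simp [tau]

variable [FiniteDimensional ℝ V]

theorem lam_add_apply (D : M.ParabolicData) (x y : D.T) (v : V) :
    D.lam (x + y) v = D.lam x (D.lam y v) := by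
  have h0 := M.form_self_of_mem_frontier D.v₀_mem
  have hx : M.form D.v₀ (D.a x : V) = 0 := (D.a x).2.1
  have hy : M.form D.v₀ (D.a y : V) = 0 := (D.a y).2.1
  have hy' : M.form (D.a y : V) D.v₀ = 0 := by rw [M.symm]; exact hy
  have hs := M.symm (D.a y : V) (D.a x : V)
  simp only [lam, nu, LinearMap.coe_mk, AddHom.coe_mk, map_add, map_sub, map_smul,
    LinearMap.add_apply, Submodule.coe_add, h0, hx, hy', hs]
  module

theorem tau_add (D : M.ParabolicData) (x y : D.T) :
    D.tau (x + y) = D.lam x (D.tau y) + D.tau x := by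
  have h0 := M.form_self_of_mem_frontier D.v₀_mem
  have hx : M.form D.v₀ (D.a x : V) = 0 := (D.a x).2.1
  have hy : M.form (y : V) D.v₀ = 0 := by rw [M.symm]; exact (D.T_le y.2).1
  have hs := D.a_symm y x
  have hs' := M.symm (D.a x : V) (y : V)
  simp only [lam, tau, nu, LinearMap.coe_mk, AddHom.coe_mk, map_add, map_sub, map_smul,
    LinearMap.add_apply, Submodule.coe_add, h0, hx, hy, hs, hs']
  module

/-- The affine transformation `γ_x(v) = λ(x)v + τ(x)`. -/
noncomputable def gamma (D : M.ParabolicData) (x : D.T) : V ≃ᵃ[ℝ] V where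
  toFun v := D.lam x v + D.tau x
  invFun v := D.lam (-x) v + D.tau (-x)
  left_inv v := by
    have h1 := D.lam_add_apply (-x) x v
    have h2 := D.tau_add (-x) x
    rw [neg_add_cancel, lam_zero_apply] at h1
    rw [neg_add_cancel, tau_zero] at h2
    simp only [map_add]
    rw [← h1, add_assoc, ← h2, add_zero]
  right_inv v := by
    have h1 := D.lam_add_apply x (-x) v
    have h2 := D.tau_add x (-x)
    rw [add_neg_cancel, lam_zero_apply] at h1
    rw [add_neg_cancel, tau_zero] at h2
    simp only [map_add]
    rw [← h1, add_assoc, ← h2, add_zero]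
  linear := LinearEquiv.ofLinearMap (D.lam x) (D.lam (-x))
    (by
      ext v
      have h1 := D.lam_add_apply x (-x) v
      rw [add_neg_cancel, lam_zero_apply] at h1
      exact h1.symm)
    (by
      ext v
      have h1 := D.lam_add_apply (-x) x v
      rw [neg_add_cancel, lam_zero_apply] at h1
      exact h1.symm)
  map_vadd' v w := by
    simp [add_assoc]

/-- The affine action `x ↦ γ_x` of the vector group `T` on `V`. -/
noncomputable def gammaHom (D : M.ParabolicData) : Multiplicative D.T →* (V ≃ᵃ[ℝ] V) where
  toFun x := D.gamma x.toAdd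
  map_one' := by
    ext v
    change D.lam 0 v + D.tau 0 = v
    rw [lam_zero_apply, tau_zero, add_zero]
  map_mul' x y := by
    ext v
    change D.lam (x.toAdd + y.toAdd) v + D.tau (x.toAdd + y.toAdd) =
      D.lam x.toAdd (D.lam y.toAdd v + D.tau y.toAdd) + D.tau x.toAdd
    rw [lam_add_apply, tau_add, map_add, add_assoc]

/-- The group `{γ_x | x ∈ Λ}` of affine transformations of `V`. -/
noncomputable def group (D : M.ParabolicData) : Subgroup (V ≃ᵃ[ℝ] V) :=
  (AddSubgroup.toSubgroup D.Λ).map D.gammaHom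

end ParabolicData

end TypeII

end Minkowski

/-! For part (1) one may take `Γ' = Γ`. Causality says that every displacement γv − v with γ ≠ 1 is
spacelike. Strict causality extends this from Γ to the real span of its parameters: integral
multiples of a vector of the span come back arbitrarily close to the group
(`AddSubgroup.exists_norm_nsmul_sub_lt`), so a displacement along C in the span would make the past
ray of a point accumulate on its future, which `IsFlatGroup.eq_zero_of_mem_closure_future` excludes.
If Γ consists of translations, its span T is therefore spacelike. The orthogonal complement of T is
either a timelike line (type (i)) or contains a null frame (type (ii) with a = 0). Otherwise a trace
computation yields an isotropic v₀ fixed by all linear parts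
(`IsFlatGroup.linear_one_or_exists_fixed`), each linear part is some ν(α) (`IsNullFrame.eq_nu`), and
causality puts the translation parts into v₀^⊥ and makes Γ abelian
(`IsFlatGroup.exists_parabolicParam`). Thus Γ becomes an additive group of pairs (α,b), and the span
argument shows that b + sα lies in ℝv₀ for no nonzero (α,b) of the span and no real s
(`IsParabolicParam.eq_zero_of_nproj_eq_zero`). The case s = 0 makes α a function of b, which gives
the map a; all s together give (*).

For part (2), γ_x keeps s = ℓ(v₀,v) and translates the N-component of v by (1 + sa)x. By (*) and
compactness ‖(1 + sa)x‖ ≥ m‖x‖ uniformly for bounded s, which gives freeness, properness, and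
spacelike y − γ_x v for y near v and all large x. So near v only finitely many of the cones γv ± C
are met, and their union is closed.

For part (3), the family 1 + sa of injective maps T → N over the line is trivialized by a continuous
family in GL(N) (`exists_trivialization`). This produces a homeomorphism of V conjugating the
translations by T to the action of T. -/

namespace Minkowski

/-! ### Geometry of the Lorentz cone -/

section Cone

variable {V : Type*} [AddCommGroup V] [Module ℝ V] (M : Minkowski V)

/-- If ℓ(w,w) ≥ 0, the plane of e and w would meet f^⊥ in a vector of nonnegative square, f being
the timelike vector supplied by `lorentzian`. Hence any timelike vector can play the role of f. -/
theorem form_self_neg_of_orthogonal {e w : V} (he : 0 < M.form e e) (hew : M.form e w = 0)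
    (hw : w ≠ 0) : M.form w w < 0 := by
  obtain ⟨f, hf, hneg⟩ := M.lorentzian
  have hwe : M.form w e = 0 := by rw [M.symm]; exact hew
  by_contra hq
  rw [not_lt] at hq
  set z : V := M.form f w • e - M.form f e • w with hz
  have hfz : M.form f z = 0 := by
    simp only [hz, map_sub, map_smul, smul_eq_mul]; ring
  have hzz : M.form z z = M.form f w ^ 2 * M.form e e + M.form f e ^ 2 * M.form w w := by
    simp only [hz, map_sub, map_smul, LinearMap.sub_apply, LinearMap.smul_apply, smul_eq_mul,
      hew, hwe]
    ring
  have h1 : 0 ≤ M.form f w ^ 2 * M.form e e := by positivity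
  have h2 : 0 ≤ M.form f e ^ 2 * M.form w w := by positivity
  have hz0 : z = 0 := by
    by_contra h
    linarith [hneg z hfz h]
  rw [hz0, map_zero] at hzz
  have h3 : M.form f w ^ 2 * M.form e e = 0 := by linarith
  have h4 : M.form f w = 0 := by simpa [he.ne'] using h3
  linarith [hneg w h4 hw]

theorem form_self_nonneg {v : V} (hv : v ∈ M.cone) : 0 ≤ M.form v v := by
  obtain ⟨e, he, hC⟩ := M.cone_eq
  rw [hC] at hv
  exact hv.1

theorem form_add_self (v w : V) :
    M.form (v + w) (v + w) = M.form v v + 2 * M.form v w + M.form w w := by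
  rw [map_add, map_add, LinearMap.add_apply, LinearMap.add_apply, M.symm w v]; ring

theorem form_sub_self (v w : V) :
    M.form (v - w) (v - w) = M.form v v - 2 * M.form v w + M.form w w := by
  rw [map_sub, map_sub, LinearMap.sub_apply, LinearMap.sub_apply, M.symm w v]; ring

theorem form_smul_self (t : ℝ) (v : V) : M.form (t • v) (t • v) = t ^ 2 * M.form v v := by
  simp only [map_smul, LinearMap.smul_apply, smul_eq_mul]; ring

theorem zero_mem_cone : (0 : V) ∈ M.cone := by
  obtain ⟨e, he, hC⟩ := M.cone_eq
  rw [hC]; simp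

theorem mem_cone_or_neg_mem_cone {v : V} (hv : 0 ≤ M.form v v) : v ∈ M.cone ∨ -v ∈ M.cone := by
  obtain ⟨e, he, hC⟩ := M.cone_eq
  rw [hC]
  rcases le_total 0 (M.form e v) with h | h
  · exact Or.inl ⟨hv, h⟩
  · right; simpa using ⟨hv, h⟩

/-- The combination of u and v orthogonal to e has nonpositive square; expanding that square bounds
ℓ(e,u)ℓ(e,v)ℓ(u,v) below by zero. -/
theorem form_nonneg {u v : V} (hu : u ∈ M.cone) (hv : v ∈ M.cone) : 0 ≤ M.form u v := by
  obtain ⟨e, he, hC⟩ := M.cone_eq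
  rw [hC] at hu hv
  obtain ⟨hu, hu'⟩ := hu
  obtain ⟨hv, hv'⟩ := hv
  rcases hu'.eq_or_lt with h | h
  · have : u = 0 := by
      by_contra hu0
      linarith [M.form_self_neg_of_orthogonal he h.symm hu0]
    simp [this]
  rcases hv'.eq_or_lt with h' | h'
  · have : v = 0 := by
      by_contra hv0
      linarith [M.form_self_neg_of_orthogonal he h'.symm hv0]
    simp [this]
  set p : V := M.form e v • u - M.form e u • v with hp
  have hep : M.form e p = 0 := by
    simp only [hp, map_sub, map_smul, smul_eq_mul]; ring
  have hpp : M.form p p = M.form e v ^ 2 * M.form u u + M.form e u ^ 2 * M.form v v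
      - 2 * (M.form e v * M.form e u) * M.form u v := by
    simp only [hp, map_sub, map_smul, LinearMap.sub_apply, LinearMap.smul_apply, smul_eq_mul,
      M.symm v u]
    ring
  have hp0 : M.form p p ≤ 0 := by
    by_cases h0 : p = 0
    · simp [h0]
    · exact (M.form_self_neg_of_orthogonal he hep h0).le
  have h1 : 0 ≤ M.form e v ^ 2 * M.form u u := by positivity
  have h2 : 0 ≤ M.form e u ^ 2 * M.form v v := by positivity
  have h3 : 0 ≤ (M.form e v * M.form e u) * M.form u v := by linarith
  exact nonneg_of_mul_nonneg_right h3 (by positivity)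

theorem add_mem_cone {u v : V} (hu : u ∈ M.cone) (hv : v ∈ M.cone) : u + v ∈ M.cone := by
  have h1 : 0 ≤ M.form (u + v) (u + v) := by
    rw [form_add_self]
    linarith [M.form_self_nonneg hu, M.form_self_nonneg hv, M.form_nonneg hu hv]
  obtain ⟨e, he, hC⟩ := M.cone_eq
  rw [hC] at hu hv ⊢
  exact ⟨h1, by rw [map_add]; exact add_nonneg hu.2 hv.2⟩

theorem smul_mem_cone {v : V} (hv : v ∈ M.cone) {t : ℝ} (ht : 0 ≤ t) : t • v ∈ M.cone := by
  obtain ⟨e, he, hC⟩ := M.cone_eq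
  rw [hC] at hv ⊢
  obtain ⟨h1, h2⟩ := hv
  constructor
  · simp only [map_smul, LinearMap.smul_apply, smul_eq_mul]; positivity
  · simp only [map_smul, smul_eq_mul]; positivity

theorem eq_zero_of_mem_cone_of_neg_mem_cone {v : V} (hv : v ∈ M.cone) (hv' : -v ∈ M.cone) :
    v = 0 := by
  obtain ⟨e, he, hC⟩ := M.cone_eq
  rw [hC] at hv hv'
  have h1 := hv'.2
  rw [map_neg] at h1
  by_contra h0
  linarith [M.form_self_neg_of_orthogonal he (le_antisymm (by linarith) hv.2) h0, hv.1]

theorem eq_zero_of_add_eq_zero {u v : V} (hu : u ∈ M.cone) (hv : v ∈ M.cone) (h : u + v = 0) :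
    u = 0 :=
  M.eq_zero_of_mem_cone_of_neg_mem_cone hu (by rwa [← eq_neg_of_add_eq_zero_right h])

theorem exists_timelike : ∃ e ∈ M.cone, 0 < M.form e e := by
  obtain ⟨e, he, hC⟩ := M.cone_eq
  exact ⟨e, by rw [hC]; exact ⟨he.le, he.le⟩, he⟩

/-- Any timelike vector of the cone `C` determines it. -/
theorem cone_eq_of_timelike {e : V} (heC : e ∈ M.cone) (he : 0 < M.form e e) :
    M.cone = {v | 0 ≤ M.form v v ∧ 0 ≤ M.form e v} := by
  ext v
  refine ⟨fun hv => ⟨M.form_self_nonneg hv, M.form_nonneg heC hv⟩, fun ⟨h1, h2⟩ => ?_⟩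
  rcases M.mem_cone_or_neg_mem_cone h1 with h | h
  · exact h
  have h3 := M.form_nonneg heC h
  rw [map_neg] at h3
  have h4 : v = 0 := by
    by_contra h0
    linarith [M.form_self_neg_of_orthogonal he (le_antisymm (by linarith) h2) h0]
  rw [h4]; exact M.zero_mem_cone

/-- The cone `C` is self-dual. -/
theorem mem_cone_of_forall_form_nonneg {v : V} (h : ∀ f ∈ M.cone, 0 ≤ M.form f v) :
    v ∈ M.cone := by
  obtain ⟨e, heC, he⟩ := M.exists_timelike
  rw [M.cone_eq_of_timelike heC he]
  have hev := h e heC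
  refine ⟨?_, hev⟩
  set t : ℝ := M.form e v / M.form e e with ht
  set w : V := v - t • e with hw
  have hte : t * M.form e e = M.form e v := by rw [ht]; field_simp
  have ht0 : 0 ≤ t := by positivity
  have hew : M.form e w = 0 := by
    simp only [hw, map_sub, map_smul, smul_eq_mul, hte, sub_self]
  have hwe : M.form w e = 0 := by rw [M.symm]; exact hew
  have hv : v = t • e + w := by rw [hw]; abel
  by_cases hw0 : w = 0
  · rw [hv, hw0]
    simp only [add_zero, map_smul, LinearMap.smul_apply, smul_eq_mul]
    positivity
  have hww := M.form_self_neg_of_orthogonal he hew hw0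
  -- This r makes re + w isotropic. Testing v = te + w against that boundary vector gives r ≤ t,
  -- that is ℓ(v,v) ≥ 0.
  set r : ℝ := √(-M.form w w / M.form e e) with hr
  have hr2 : r ^ 2 * M.form e e = -M.form w w := by
    rw [hr, Real.sq_sqrt (by apply div_nonneg <;> linarith)]; field_simp
  have hr0 : 0 < r := by
    rw [hr]; apply Real.sqrt_pos.mpr; apply div_pos <;> linarith
  have hf : r • e + w ∈ M.cone := by
    rw [M.cone_eq_of_timelike heC he]
    constructor
    · simp only [map_add, map_smul, LinearMap.add_apply, LinearMap.smul_apply, smul_eq_mul,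
        hew, hwe]
      nlinarith
    · simp only [map_add, map_smul, smul_eq_mul, hew]; positivity
  have hfv := h _ hf
  have h1 : M.form (r • e + w) v = (r * M.form e e) * (t - r) := by
    rw [hv]
    simp only [map_add, map_smul, LinearMap.add_apply, LinearMap.smul_apply, smul_eq_mul,
      hew, hwe]
    linear_combination hr2
  rw [h1] at hfv
  have h2 : 0 ≤ t - r := nonneg_of_mul_nonneg_right hfv (by positivity)
  have h3 : M.form v v = (t ^ 2 - r ^ 2) * M.form e e := by
    rw [hv]
    simp only [map_add, map_smul, LinearMap.add_apply, LinearMap.smul_apply, smul_eq_mul,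
      hew, hwe]
    linear_combination hr2
  rw [h3]
  have : 0 ≤ t ^ 2 - r ^ 2 := by nlinarith
  positivity

end Cone

/-! ### Null frames and parabolic affine maps -/

section NullFrame

variable {V : Type*} [AddCommGroup V] [Module ℝ V] {M : Minkowski V}

/-- A pair of isotropic vectors of `C` with `ℓ(v₀,v₁) = 1`. -/
structure IsNullFrame (M : Minkowski V) (v₀ v₁ : V) : Prop where
  mem₀ : v₀ ∈ M.cone
  mem₁ : v₁ ∈ M.cone
  self₀ : M.form v₀ v₀ = 0
  self₁ : M.form v₁ v₁ = 0
  form_eq : M.form v₀ v₁ = 1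

/-- The component in `v₀^⊥ ∩ v₁^⊥` of a vector. -/
noncomputable def nproj (M : Minkowski V) (v₀ v₁ : V) : V →ₗ[ℝ] V :=
  LinearMap.id - (M.form v₁).smulRight v₀ - (M.form v₀).smulRight v₁

theorem nproj_apply (v₀ v₁ v : V) :
    M.nproj v₀ v₁ v = v - M.form v₁ v • v₀ - M.form v₀ v • v₁ := rfl

variable (M) in
theorem eq_add_nproj (v₀ v₁ v : V) :
    v = M.form v₁ v • v₀ + M.form v₀ v • v₁ + M.nproj v₀ v₁ v := by
  rw [nproj_apply]; abel

namespace IsNullFrame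

variable {v₀ v₁ : V} (h : M.IsNullFrame v₀ v₁)
include h

theorem swap : M.IsNullFrame v₁ v₀ :=
  ⟨h.mem₁, h.mem₀, h.self₁, h.self₀, by rw [M.symm]; exact h.form_eq⟩

theorem form_nproj₀ (v : V) : M.form v₀ (M.nproj v₀ v₁ v) = 0 := by
  simp [nproj_apply, h.self₀, h.form_eq]

theorem form_nproj₁ (v : V) : M.form v₁ (M.nproj v₀ v₁ v) = 0 := by
  simp [nproj_apply, h.self₁, M.symm v₁ v₀, h.form_eq]

theorem form_self (v : V) :
    M.form v v = 2 * M.form v₀ v * M.form v₁ v +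
      M.form (M.nproj v₀ v₁ v) (M.nproj v₀ v₁ v) := by
  simp only [nproj_apply, map_sub, map_smul, LinearMap.sub_apply, LinearMap.smul_apply,
    smul_eq_mul, h.self₀, h.self₁, M.symm v₁ v₀, h.form_eq, M.symm v v₀, M.symm v v₁]
  ring

theorem form_self_neg {n : V} (h₀ : M.form v₀ n = 0) (h₁ : M.form v₁ n = 0) (hn : n ≠ 0) :
    M.form n n < 0 := by
  refine M.form_self_neg_of_orthogonal (e := v₀ + v₁) ?_ ?_ hn
  · rw [form_add_self, h.self₀, h.self₁, h.form_eq]; norm_num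
  · rw [map_add, LinearMap.add_apply, h₀, h₁, add_zero]

theorem form_nproj_nonpos (v : V) : M.form (M.nproj v₀ v₁ v) (M.nproj v₀ v₁ v) ≤ 0 := by
  by_cases h0 : M.nproj v₀ v₁ v = 0
  · simp [h0]
  · exact (h.form_self_neg (h.form_nproj₀ v) (h.form_nproj₁ v) h0).le

theorem mem_cone_iff {v : V} :
    v ∈ M.cone ↔ 0 ≤ M.form v v ∧ 0 ≤ M.form v₀ v ∧ 0 ≤ M.form v₁ v := by
  refine ⟨fun hv => ⟨M.form_self_nonneg hv, M.form_nonneg h.mem₀ hv, M.form_nonneg h.mem₁ hv⟩,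
    fun ⟨h1, h2, h3⟩ => ?_⟩
  rw [M.cone_eq_of_timelike (M.add_mem_cone h.mem₀ h.mem₁)]
  · exact ⟨h1, by rw [map_add, LinearMap.add_apply]; exact add_nonneg h2 h3⟩
  · rw [form_add_self, h.self₀, h.self₁, h.form_eq]; norm_num

/-- On v₀^⊥ the form sees only the component in v₀^⊥ ∩ v₁^⊥, where it is negative definite. -/
theorem eq_smul_of_orthogonal {v : V} (hv : M.form v₀ v = 0) (hq : 0 ≤ M.form v v) :
    v = M.form v₁ v • v₀ := by
  have h1 := h.form_self v
  rw [hv, mul_zero, zero_mul, zero_add] at h1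
  have h2 : M.nproj v₀ v₁ v = 0 := by
    by_contra h0
    linarith [h.form_self_neg (h.form_nproj₀ v) (h.form_nproj₁ v) h0]
  have h3 := M.eq_add_nproj v₀ v₁ v
  rwa [hv, h2, zero_smul, add_zero, add_zero] at h3

theorem ne_zero : v₀ ≠ 0 := by
  rintro rfl
  simpa using h.form_eq

theorem nproj_eq_zero_iff {v : V} (hv : M.form v₀ v = 0) :
    M.nproj v₀ v₁ v = 0 ↔ M.form v v = 0 := by
  have h1 := h.form_self v
  rw [hv, mul_zero, zero_mul, zero_add] at h1
  rw [h1]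
  refine ⟨fun h0 => by simp [h0], fun h2 => ?_⟩
  by_contra h0
  linarith [h.form_self_neg (h.form_nproj₀ v) (h.form_nproj₁ v) h0]

end IsNullFrame

/-- The affine mapping `v ↦ ν(α)v + b - ½ ℓ(α,b) v₀`. -/
noncomputable def parabolicMap (M : Minkowski V) (v₀ α b v : V) : V :=
  M.nu v₀ α v + (b - (1 / 2 * M.form α b) • v₀)

theorem nu_apply (v₀ x v : V) : M.nu v₀ x v = v + M.form v₀ v • x -
    (M.form v x + 1 / 2 * M.form v₀ v * M.form x x) • v₀ := by
  rw [M.symm v₀ v]; rfl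

theorem parabolicMap_sub_self (v₀ α b v : V) : M.parabolicMap v₀ α b v - v =
    M.form v₀ v • α + b -
      (M.form v α + 1 / 2 * M.form v₀ v * M.form α α + 1 / 2 * M.form α b) • v₀ := by
  rw [parabolicMap, nu_apply]; module

section Isotropic

variable {v₀ : V} (h₀ : M.form v₀ v₀ = 0)
include h₀

theorem form_nu_nu {α : V} (hα : M.form v₀ α = 0) (v w : V) :
    M.form (M.nu v₀ α v) (M.nu v₀ α w) = M.form v w := by
  simp only [nu_apply, map_add, map_sub, map_smul, LinearMap.add_apply, LinearMap.sub_apply,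
    LinearMap.smul_apply, smul_eq_mul, h₀, hα, M.symm α v₀, M.symm v v₀, M.symm α w]
  ring

theorem form_nu {α : V} (hα : M.form v₀ α = 0) (v : V) :
    M.form v₀ (M.nu v₀ α v) = M.form v₀ v := by
  simp [nu_apply, h₀, hα]

theorem form_parabolicMap {α b : V} (hα : M.form v₀ α = 0) (hb : M.form v₀ b = 0) (v : V) :
    M.form v₀ (M.parabolicMap v₀ α b v) = M.form v₀ v := by
  simp [parabolicMap, form_nu h₀ hα, h₀, hb]

theorem form_smul_add_sub_smul {x : V} (hx : M.form v₀ x = 0) (c : ℝ) :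
    M.form (x - c • v₀) (x - c • v₀) = M.form x x := by
  simp [h₀, hx, M.symm x v₀]

theorem nu_add {α α' : V} (hα : M.form v₀ α = 0) (hα' : M.form v₀ α' = 0) (v : V) :
    M.nu v₀ (α + α') v = M.nu v₀ α (M.nu v₀ α' v) := by
  simp only [nu_apply, map_add, map_sub, map_smul, LinearMap.add_apply, h₀, hα, hα',
    M.symm α' α]
  module

theorem nu_add_smul {α : V} (hα : M.form v₀ α = 0) (c : ℝ) (v : V) :
    M.nu v₀ (α + c • v₀) v = M.nu v₀ α v := by
  simp only [nu_apply, map_add, map_smul, LinearMap.add_apply, LinearMap.smul_apply, smul_eq_mul,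
    h₀, hα, M.symm α v₀, M.symm v v₀]
  module

/-- Only α modulo v₀ matters, which permits a later change of the second null vector. -/
theorem parabolicMap_add_smul {α b : V} (hα : M.form v₀ α = 0) (hb : M.form v₀ b = 0) (c : ℝ)
    (v : V) : M.parabolicMap v₀ (α + c • v₀) b v = M.parabolicMap v₀ α b v := by
  rw [parabolicMap, nu_add_smul h₀ hα, parabolicMap]
  simp [hb]

end Isotropic

/-- Since ν(α) keeps ℓ and ℓ(v₀,·), only the sign of the product with v₁ is at stake. If ℓ(v₀,v) >
0, the inequality 2ℓ(v₀,·)ℓ(v₁,·) ≥ ℓ(·,·) ≥ 0 decides it; if ℓ(v₀,v) = 0, then v is a multiple of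
v₀ and is fixed. -/
theorem IsNullFrame.nu_mem_cone {v₀ v₁ : V} (h : M.IsNullFrame v₀ v₁) {α v : V}
    (hα : M.form v₀ α = 0) (hv : v ∈ M.cone) : M.nu v₀ α v ∈ M.cone := by
  have hq : 0 ≤ M.form (M.nu v₀ α v) (M.nu v₀ α v) := by
    rw [form_nu_nu h.self₀ hα]; exact M.form_self_nonneg hv
  obtain ⟨h1, h2, h3⟩ := h.mem_cone_iff.mp hv
  rcases h2.eq_or_lt with h4 | h4
  · have h5 := h.eq_smul_of_orthogonal h4.symm h1
    have h6 : M.nu v₀ α v = v := by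
      have : M.form v α = 0 := by rw [h5]; simp [hα]
      rw [nu_apply, ← h4, this]; module
    rwa [h6]
  · refine h.mem_cone_iff.mpr ⟨hq, by rw [form_nu h.self₀ hα]; exact h2, ?_⟩
    have h5 := h.form_self (M.nu v₀ α v)
    rw [form_nu h.self₀ hα] at h5
    have h6 := h.form_nproj_nonpos (M.nu v₀ α v)
    have h7 : 0 ≤ M.form v₀ v * M.form v₁ (M.nu v₀ α v) := by linarith
    exact nonneg_of_mul_nonneg_right h7 h4

end NullFrame

/-! ### Continuity and norm estimates for the form -/

section Topology

theorem IsNullFrame.mem_frontier₀ {V : Type*} [NormedAddCommGroup V] [NormedSpace ℝ V]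
    {M : Minkowski V} {v₀ v₁ : V} (h : M.IsNullFrame v₀ v₁) :
    v₀ ∈ frontier M.cone := by
  refine ⟨subset_closure h.mem₀, fun hi => ?_⟩
  -- Moving from v₀ in the direction −v₁ gives the square −2t, so v₀ is not interior.
  have hc : Continuous fun t : ℝ => v₀ - t • v₁ := by fun_prop
  have h1 : ∀ᶠ t in 𝓝 (0 : ℝ), v₀ - t • v₁ ∈ M.cone :=
    hc.continuousAt.eventually_mem (by simpa using mem_interior_iff_mem_nhds.mp hi)
  obtain ⟨ε, hε, h2⟩ := Metric.eventually_nhds_iff.mp h1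
  have h3 := M.form_self_nonneg (h2 (y := ε / 2) (by
    rw [Real.dist_eq, sub_zero, abs_of_pos (by positivity)]; linarith))
  rw [form_sub_self, map_smul, map_smul, map_smul, LinearMap.smul_apply, h.self₀, h.self₁,
    h.form_eq] at h3
  simp only [smul_eq_mul] at h3
  linarith

variable {V : Type*} [NormedAddCommGroup V] [NormedSpace ℝ V] [FiniteDimensional ℝ V]
  (M : Minkowski V)

theorem continuous_form : Continuous fun p : V × V => M.form p.1 p.2 := by
  have h1 : Continuous fun w : V => LinearMap.toContinuousLinearMap (M.form w) :=
    LinearMap.continuous_of_finiteDimensional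
      (LinearMap.toContinuousLinearMap.toLinearMap ∘ₗ M.form)
  exact (h1.comp continuous_fst).clm_apply continuous_snd

variable {M} in
theorem _root_.Continuous.minkowski_form {X : Type*} [TopologicalSpace X] {f g : X → V}
    (hf : Continuous f) (hg : Continuous g) : Continuous fun x => M.form (f x) (g x) :=
  M.continuous_form.comp (hf.prodMk hg)

theorem isClosed_cone : IsClosed M.cone := by
  obtain ⟨e, he, hC⟩ := M.cone_eq
  rw [hC]
  exact (isClosed_le continuous_const (continuous_id.minkowski_form continuous_id)).inter
    (isClosed_le continuous_const (continuous_const.minkowski_form continuous_id))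

theorem exists_form_le : ∃ K, 0 < K ∧ ∀ v w, |M.form v w| ≤ K * ‖v‖ * ‖w‖ := by
  let B : V →L[ℝ] V →L[ℝ] ℝ := LinearMap.toContinuousLinearMap
    (LinearMap.toContinuousLinearMap.toLinearMap ∘ₗ M.form)
  refine ⟨‖B‖ + 1, by positivity, fun v w => ?_⟩
  have h1 := B.le_opNorm₂ v w
  have h2 : (0 : ℝ) ≤ ‖v‖ * ‖w‖ := by positivity
  calc |M.form v w| = ‖B v w‖ := rfl
    _ ≤ (‖B‖ + 1) * ‖v‖ * ‖w‖ := by nlinarith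

/-- A quantitative form of negative definiteness on a subspace. -/
theorem exists_form_self_le (W : Submodule ℝ V) (hW : ∀ w ∈ W, w ≠ 0 → M.form w w < 0) :
    ∃ c, 0 < c ∧ ∀ w ∈ W, M.form w w ≤ -c * ‖w‖ ^ 2 := by
  have hcont : Continuous fun w : W => M.form w w :=
    continuous_subtype_val.minkowski_form continuous_subtype_val
  rcases (Metric.sphere (0 : W) 1).eq_empty_or_nonempty with hs | hs
  -- An empty unit sphere means W = 0.
  · refine ⟨1, one_pos, fun w hw => ?_⟩
    have : w = 0 := by
      by_contra h0
      have h1 : (⟨‖w‖⁻¹ • w, W.smul_mem _ hw⟩ : W) ∈ Metric.sphere (0 : W) 1 := by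
        simp [norm_smul, h0]
      rw [hs] at h1
      exact h1
    simp [this]
  obtain ⟨u, hu, hmax⟩ := (isCompact_sphere (0 : W) 1).exists_isMaxOn hs hcont.continuousOn
  have hu0 : (u : V) ≠ 0 := by
    intro h0
    have : u = 0 := by ext; exact h0
    simp [this] at hu
  refine ⟨-M.form u u, by linarith [hW u u.2 hu0], fun w hw => ?_⟩
  by_cases h0 : w = 0
  · simp [h0]
  have h1 : (⟨‖w‖⁻¹ • w, W.smul_mem _ hw⟩ : W) ∈ Metric.sphere (0 : W) 1 := by
    simp [norm_smul, h0]
  have h2 : M.form (‖w‖⁻¹ • w) (‖w‖⁻¹ • w) ≤ M.form u u := hmax h1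
  have h3 : w = ‖w‖ • (‖w‖⁻¹ • w) := by rw [smul_smul, mul_inv_cancel₀ (by simpa), one_smul]
  have h4 : M.form w w = ‖w‖ ^ 2 * M.form (‖w‖⁻¹ • w) (‖w‖⁻¹ • w) := by
    conv_lhs => rw [h3]
    rw [form_smul_self]
  rw [h4]
  nlinarith [sq_nonneg ‖w‖]

theorem mem_cone_of_mem_frontier {v : V} (hv : v ∈ frontier M.cone) : v ∈ M.cone :=
  M.isClosed_cone.frontier_subset hv

variable {M}

theorem isNullFrame_of_mem_frontier {v₀ v₁ : V} (h₀ : v₀ ∈ frontier M.cone)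
    (h₁ : v₁ ∈ frontier M.cone) (h : M.form v₀ v₁ = 1) : M.IsNullFrame v₀ v₁ :=
  ⟨M.mem_cone_of_mem_frontier h₀, M.mem_cone_of_mem_frontier h₁,
    M.form_self_of_mem_frontier h₀, M.form_self_of_mem_frontier h₁, h⟩

end Topology

end Minkowski

/-! ### Causality of the quotient expressed by orbits in V -/

namespace Minkowski

section Proj

variable {V : Type*} [AddCommGroup V] [Module ℝ V] {Γ : Subgroup (V ≃ᵃ[ℝ] V)}

theorem proj_eq_proj_iff {v w : V} :
    FlatQuotient.proj Γ v = FlatQuotient.proj Γ w ↔ ∃ γ ∈ Γ, γ w = v := by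
  rw [FlatQuotient.proj, FlatQuotient.proj, Quotient.eq]
  change v ∈ MulAction.orbit Γ w ↔ _
  exact ⟨fun ⟨γ, hγ⟩ => ⟨γ.1, γ.2, hγ⟩, fun ⟨γ, hγ, h⟩ => ⟨⟨γ, hγ⟩, h⟩⟩

theorem proj_apply_of_mem {γ : V ≃ᵃ[ℝ] V} (hγ : γ ∈ Γ) (v : V) :
    FlatQuotient.proj Γ (γ v) = FlatQuotient.proj Γ v :=
  proj_eq_proj_iff.mpr ⟨γ, hγ, rfl⟩

theorem proj_surjective : Function.Surjective (FlatQuotient.proj Γ) := Quotient.mk_surjective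

theorem affineEquiv_sub (γ : V ≃ᵃ[ℝ] V) (v w : V) : γ v - γ w = γ.linear (v - w) :=
  (γ.toAffineMap.linearMap_vsub v w).symm

theorem affineEquiv_add (γ : V ≃ᵃ[ℝ] V) (v w : V) : γ (v + w) = γ v + γ.linear w := by
  rw [← sub_eq_iff_eq_add', affineEquiv_sub, add_sub_cancel_left]

end Proj

section Causality

variable {V : Type*} [NormedAddCommGroup V] [NormedSpace ℝ V] {M : Minkowski V}
  {Γ : Subgroup (V ≃ᵃ[ℝ] V)}

theorem continuous_proj : Continuous (FlatQuotient.proj Γ) := continuous_quot_mk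

theorem isOpenMap_proj [FiniteDimensional ℝ V] : IsOpenMap (FlatQuotient.proj Γ) := by
  have : ContinuousConstSMul Γ V :=
    ⟨fun γ => AffineMap.continuous_of_finiteDimensional γ.1.toAffineMap⟩
  exact isOpenMap_quotient_mk'_mul

theorem IsFlatGroup.linear_mem_cone (hΓ : M.IsFlatGroup Γ) {γ : V ≃ᵃ[ℝ] V} (hγ : γ ∈ Γ) {c : V}
    (hc : c ∈ M.cone) : γ.linear c ∈ M.cone := by
  rw [← hΓ.cone_eq γ hγ]; exact ⟨c, hc, rfl⟩

theorem IsFlatGroup.proj_mem_future_iff (hΓ : M.IsFlatGroup Γ) {v y : V} :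
    FlatQuotient.proj Γ y ∈ M.future Γ (FlatQuotient.proj Γ v) ↔ ∃ γ ∈ Γ, y - γ v ∈ M.cone := by
  constructor
  · rintro ⟨w, hw, c, hc, hy⟩
    obtain ⟨g, hg, rfl⟩ := proj_eq_proj_iff.mp hw
    obtain ⟨k, hk, rfl⟩ := proj_eq_proj_iff.mp hy
    refine ⟨k * g, mul_mem hk hg, ?_⟩
    rw [affineEquiv_add]
    change k (g v) + _ - k (g v) ∈ _
    rw [add_sub_cancel_left]
    exact hΓ.linear_mem_cone hk hc
  · rintro ⟨g, hg, h⟩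
    exact ⟨g v, proj_apply_of_mem hg v, _, h, by rw [add_sub_cancel]⟩

theorem IsFlatGroup.proj_mem_past_iff (hΓ : M.IsFlatGroup Γ) {v y : V} :
    FlatQuotient.proj Γ y ∈ M.past Γ (FlatQuotient.proj Γ v) ↔ ∃ γ ∈ Γ, -(y - γ v) ∈ M.cone := by
  constructor
  · rintro ⟨w, hw, c, hc, hy⟩
    obtain ⟨g, hg, rfl⟩ := proj_eq_proj_iff.mp hw
    obtain ⟨k, hk, rfl⟩ := proj_eq_proj_iff.mp hy
    refine ⟨k * g, mul_mem hk hg, ?_⟩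
    rw [sub_eq_add_neg (g v) c, affineEquiv_add]
    change -(k (g v) + _ - k (g v)) ∈ _
    rw [add_sub_cancel_left, map_neg, neg_neg]
    exact hΓ.linear_mem_cone hk hc
  · rintro ⟨g, hg, h⟩
    exact ⟨g v, proj_apply_of_mem hg v, _, h, by rw [sub_neg_eq_add, add_sub_cancel]⟩

/-- In a causal manifold no nontrivial transformation moves a point along the cone. -/
theorem IsFlatGroup.eq_one_of_sub_mem_cone (hΓ : M.IsFlatGroup Γ) (hc : M.IsCausal Γ)
    {γ : V ≃ᵃ[ℝ] V} (hγ : γ ∈ Γ) {v : V} (h : γ v - v ∈ M.cone) : γ = 1 := by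
  by_contra hne
  set u : V := γ v - v with hu
  have hu0 : u ≠ 0 := fun h0 => hne (hΓ.free γ hγ v (sub_eq_zero.mp h0))
  have hcont : Continuous fun s : ℝ => v + s • u := by fun_prop
  -- The segment from v to γv becomes a closed timelike path. Causality would place the whole
  -- segment in one orbit, while properness allows only finitely many orbit points on it.
  let η : Path (FlatQuotient.proj Γ v) (FlatQuotient.proj Γ v) :=
    { toFun := fun s => FlatQuotient.proj Γ (v + (s : ℝ) • u)
      continuous_toFun := continuous_proj.comp (hcont.comp continuous_subtype_val)
      source' := by simp
      target' := by simp [hu, proj_apply_of_mem hγ] }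
  have hη : M.IsTimelikePath Γ η := by
    refine ⟨1, ![0, 1], ?_, rfl, rfl, fun i => ⟨fun s => v + s • u, ?_, fun s hs => ?_⟩⟩
    · intro i j hij
      fin_cases i <;> fin_cases j <;> simp_all
    · exact ContDiff.contDiffOn (by fun_prop)
    · have hi : i = 0 := Subsingleton.elim _ _
      subst hi
      have hs' : s ∈ Set.Icc (0 : ℝ) 1 := hs
      refine ⟨by rw [Path.extend_apply _ hs']; rfl, ?_⟩
      have h1 : HasDerivAt (fun s : ℝ => v + s • u) u s := by
        simpa using ((hasDerivAt_id s).smul_const u).const_add v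
      have h2 : UniqueDiffWithinAt ℝ (Set.Icc (0 : ℝ) 1) s := uniqueDiffOn_Icc zero_lt_one s hs'
      change derivWithin (fun s : ℝ => v + s • u) (Set.Icc (0 : ℝ) 1) s ∈ M.cone
      rwa [h1.hasDerivWithinAt.derivWithin h2]
  have hconst := hc _ η hη
  have hprop := hΓ.proper.finite_disjoint_inter_image (K := {v})
    (L := (fun s : ℝ => v + s • u) '' Set.Icc 0 1) isCompact_singleton
    (isCompact_Icc.image hcont)
  have hinj : Function.Injective fun s : ℝ => v + s • u := by
    intro s t hst
    exact smul_left_injective ℝ hu0 (add_left_cancel hst)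
  have hinf : ((fun s : ℝ => v + s • u) '' Set.Icc 0 1).Infinite :=
    (Set.Icc_infinite zero_lt_one).image hinj.injOn
  refine hinf ((hprop.image fun g : Γ => g • v).subset ?_)
  rintro _ ⟨s, hs, rfl⟩
  obtain ⟨g, hg, hgv⟩ := proj_eq_proj_iff.mp (hconst ⟨s, hs⟩)
  exact ⟨⟨g, hg⟩, ⟨g v, ⟨v, rfl, rfl⟩, ⟨s, hs, hgv.symm⟩⟩, hgv⟩

theorem IsFlatGroup.eq_one_of_sub_mem_neg_cone (hΓ : M.IsFlatGroup Γ) (hc : M.IsCausal Γ)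
    {γ : V ≃ᵃ[ℝ] V} (hγ : γ ∈ Γ) {v : V} (h : v - γ v ∈ M.cone) : γ = 1 := by
  have h1 : (γ⁻¹ : V ≃ᵃ[ℝ] V) (γ v) = v := γ.symm_apply_apply v
  exact inv_eq_one.mp (hΓ.eq_one_of_sub_mem_cone hc (inv_mem hγ) (v := γ v) (by rwa [h1]))

theorem IsFlatGroup.form_sub_self_neg (hΓ : M.IsFlatGroup Γ) (hc : M.IsCausal Γ)
    {γ : V ≃ᵃ[ℝ] V} (hγ : γ ∈ Γ) (hne : γ ≠ 1) (v : V) : M.form (γ v - v) (γ v - v) < 0 := by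
  by_contra h
  rcases M.mem_cone_or_neg_mem_cone (not_lt.mp h) with h1 | h1
  · exact hne (hΓ.eq_one_of_sub_mem_cone hc hγ h1)
  · exact hne (hΓ.eq_one_of_sub_mem_neg_cone hc hγ (v := v) (by rwa [neg_sub] at h1))

/-- In a strictly causal manifold the past ray of a point does not accumulate on its future. -/
theorem IsFlatGroup.eq_zero_of_mem_closure_future (hΓ : M.IsFlatGroup Γ)
    (hc : M.IsStrictlyCausal Γ) {v c : V} (hcC : c ∈ M.cone)
    (h : ∀ ε : ℝ, 0 < ε → ε < 1 → v - ε • c ∈ closure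
      (FlatQuotient.proj Γ ⁻¹' M.future Γ (FlatQuotient.proj Γ v))) : c = 0 := by
  set p := FlatQuotient.proj Γ v with hp
  obtain ⟨U, hU, hcl, -⟩ := hc.2 p
  have hcont : Continuous fun ε : ℝ => v - ε • c := by fun_prop
  have h1 : ∀ᶠ ε in 𝓝 (0 : ℝ), FlatQuotient.proj Γ (v - ε • c) ∈ interior U :=
    (continuous_proj.comp hcont).continuousAt.eventually_mem
      (interior_mem_nhds.mpr (by simpa using hU))
  obtain ⟨δ, hδ, h2⟩ := Metric.eventually_nhds_iff.mp h1
  set ε : ℝ := min (δ / 2) (1 / 2) with hε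
  have hε0 : 0 < ε := by positivity
  have h3 : FlatQuotient.proj Γ (v - ε • c) ∈ interior U := h2 (by
    rw [Real.dist_eq, sub_zero, abs_of_pos hε0]
    exact (min_le_left _ _).trans_lt (by linarith))
  have h4 : FlatQuotient.proj Γ (v - ε • c) ∈ closure (M.future Γ p) :=
    closure_mono (Set.image_preimage_subset _ _)
      (image_closure_subset_closure_image continuous_proj
        ⟨_, h ε hε0 ((min_le_right _ _).trans_lt (by norm_num)), rfl⟩)
  have h5 : FlatQuotient.proj Γ (v - ε • c) ∈ M.future Γ p := by
    refine isClosed_preimage_val.mp hcl ⟨interior_subset h3, ?_⟩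
    exact closure_mono (Set.inter_subset_inter_left _ interior_subset)
      (isOpen_interior.inter_closure ⟨h3, h4⟩)
  obtain ⟨γ, hγ, h6⟩ := hΓ.proj_mem_future_iff.mp h5
  -- Adding εc to v − εc − γv ∈ C gives v − γv ∈ C, hence γ = 1; then −εc itself lies in C.
  have h7 : γ = 1 := by
    refine hΓ.eq_one_of_sub_mem_neg_cone hc.1 hγ (v := v) ?_
    have := M.add_mem_cone h6 (M.smul_mem_cone hcC hε0.le)
    convert this using 1; abel
  rw [h7] at h6
  change v - ε • c - v ∈ M.cone at h6
  have h8 := M.eq_zero_of_mem_cone_of_neg_mem_cone (M.smul_mem_cone hcC hε0.le)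
    (by convert h6 using 1; abel)
  exact (smul_eq_zero.mp h8).resolve_left hε0.ne'

/-- By self-duality of C it suffices that ℓ(f, c(·)) is nondecreasing for every f in C. -/
theorem sub_mem_cone_of_derivWithin_mem [FiniteDimensional ℝ V] {c : ℝ → V} {a b : ℝ}
    (hc : ContDiffOn ℝ ∞ c (Set.Icc a b))
    (hd : ∀ s ∈ Set.Icc a b, derivWithin c (Set.Icc a b) s ∈ M.cone) {x y : ℝ}
    (hx : a ≤ x) (hxy : x ≤ y) (hy : y ≤ b) : c y - c x ∈ M.cone := by
  refine M.mem_cone_of_forall_form_nonneg fun f hf => ?_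
  let F : V →L[ℝ] ℝ := LinearMap.toContinuousLinearMap (M.form f)
  have hder : ∀ s ∈ interior (Set.Icc a b),
      HasDerivAt (fun s => F (c s)) (F (derivWithin c (Set.Icc a b) s)) s := by
    intro s hs
    have h1 : Set.Icc a b ∈ 𝓝 s := mem_interior_iff_mem_nhds.mp hs
    have h2 : HasDerivAt c (derivWithin c (Set.Icc a b) s) s :=
      (((hc.differentiableOn (by simp)) s (interior_subset hs)).hasDerivWithinAt).hasDerivAt h1
    exact F.hasFDerivAt.comp_hasDerivAt s h2
  have hmono : MonotoneOn (fun s => F (c s)) (Set.Icc a b) := by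
    refine monotoneOn_of_deriv_nonneg (convex_Icc a b) (F.continuous.comp_continuousOn
      hc.continuousOn) (fun s hs => (hder s hs).differentiableAt.differentiableWithinAt)
      fun s hs => ?_
    rw [(hder s hs).deriv]
    exact M.form_nonneg hf (hd s (interior_subset hs))
  rw [map_sub, sub_nonneg]
  exact hmono ⟨hx, hxy.trans hy⟩ ⟨hx.trans hxy, hy⟩ hxy

/-- Successive points of a timelike path lift to V with increments in C. For a closed path the total
increment is γv − v, so γ = 1, and two increments in C with sum zero both vanish. -/
theorem IsFlatGroup.isCausal [FiniteDimensional ℝ V] (hΓ : M.IsFlatGroup Γ)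
    (h1 : ∀ γ ∈ Γ, ∀ v, γ v - v ∈ M.cone → γ = 1) : M.IsCausal Γ := by
  rintro p η ⟨k, t, ht, ht0, ht1, hη⟩ s
  -- General subintervals [a,b] are needed because the loop is later cut at an arbitrary parameter
  -- s.
  have key : ∀ j : Fin (k + 1), ∀ a b : ℝ, 0 ≤ a → a ≤ b → b ≤ t j →
      ∀ v, FlatQuotient.proj Γ v = η.extend a →
        ∃ w, FlatQuotient.proj Γ w = η.extend b ∧ w - v ∈ M.cone := by
    intro j
    induction j using Fin.induction with
    | zero =>
      intro a b ha hab hb v hv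
      have : b = a := by rw [ht0] at hb; linarith
      exact ⟨v, by rw [hv, this], by rw [sub_self]; exact M.zero_mem_cone⟩
    | succ i ih =>
      have piece : ∀ a b : ℝ, t i.castSucc ≤ a → a ≤ b → b ≤ t i.succ →
          ∀ v, FlatQuotient.proj Γ v = η.extend a →
            ∃ w, FlatQuotient.proj Γ w = η.extend b ∧ w - v ∈ M.cone := by
        intro a b ha hab hb v hv
        obtain ⟨c, hc, hc'⟩ := hη i
        rw [(hc' a ⟨ha, hab.trans hb⟩).1] at hv
        obtain ⟨g, hg, rfl⟩ := proj_eq_proj_iff.mp hv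
        refine ⟨g (c b), ?_, ?_⟩
        · rw [(hc' b ⟨ha.trans hab, hb⟩).1, proj_apply_of_mem hg]
        · rw [affineEquiv_sub]
          exact hΓ.linear_mem_cone hg
            (sub_mem_cone_of_derivWithin_mem hc (fun s hs => (hc' s hs).2) ha hab hb)
      intro a b ha hab hb v hv
      rcases le_total b (t i.castSucc) with h | h
      · exact ih a b ha hab h v hv
      rcases le_total a (t i.castSucc) with h' | h'
      · obtain ⟨w, hw, hwv⟩ := ih a _ ha h' le_rfl v hv
        obtain ⟨z, hz, hzw⟩ := piece _ b le_rfl h hb w hw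
        exact ⟨z, hz, by simpa using M.add_mem_cone hzw hwv⟩
      · exact piece a b h' hab hb v hv
  obtain ⟨v, hv⟩ := proj_surjective p
  obtain ⟨w, hw, hwv⟩ := key (Fin.last k) 0 s le_rfl s.2.1 (by rw [ht1]; exact s.2.2) v
    (by rw [hv, η.extend_zero])
  obtain ⟨z, hz, hzw⟩ := key (Fin.last k) s 1 s.2.1 s.2.2 (by rw [ht1]) w hw
  rw [η.extend_one, ← hv] at hz
  obtain ⟨γ, hγ, rfl⟩ := proj_eq_proj_iff.mp hz
  have h2 := h1 γ hγ v (by simpa using M.add_mem_cone hzw hwv)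
  have h3 : γ v = v := by rw [h2]; rfl
  rw [h3] at hzw
  have h4 := M.eq_zero_of_add_eq_zero hwv hzw (by abel)
  rw [sub_eq_zero.mp h4, hv, Path.extend_apply _ s.2] at hw
  exact hw.symm

/-- R stands for C or −C, so futures and pasts are handled together. Over U only finitely many of
the closed sets γv + R matter, and the openness of κ carries the open complement to the quotient. -/
theorem isClosed_preimage_of_finite [FiniteDimensional ℝ V] {v : V} {U : Set V} (hU : IsOpen U)
    {R : Set V} (hR : IsClosed R) {F : Set (FlatQuotient Γ)}
    (hF : ∀ y, FlatQuotient.proj Γ y ∈ F ↔ ∃ γ ∈ Γ, y - γ v ∈ R)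
    (hfin : {γ | γ ∈ Γ ∧ ∃ y ∈ U, y - γ v ∈ R}.Finite) :
    IsClosed ((↑) ⁻¹' F : Set (FlatQuotient.proj Γ '' U)) := by
  have h1 : IsClosed (⋃ γ ∈ {γ | γ ∈ Γ ∧ ∃ y ∈ U, y - γ v ∈ R}, {y | y - γ v ∈ R}) :=
    hfin.isClosed_biUnion fun γ _ => hR.preimage (by fun_prop)
  have h2 : U \ FlatQuotient.proj Γ ⁻¹' F =
      U \ ⋃ γ ∈ {γ | γ ∈ Γ ∧ ∃ y ∈ U, y - γ v ∈ R}, {y | y - γ v ∈ R} := by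
    ext y
    simp only [Set.mem_sdiff, Set.mem_preimage, hF, Set.mem_iUnion, Set.mem_ofPred_eq, exists_prop]
    refine and_congr_right fun hy => not_congr ?_
    exact ⟨fun ⟨γ, hγ, h⟩ => ⟨γ, ⟨hγ, y, hy, h⟩, h⟩, fun ⟨γ, hγ, h⟩ => ⟨γ, hγ.1, h⟩⟩
  have h3 : IsOpen (FlatQuotient.proj Γ '' (U \ FlatQuotient.proj Γ ⁻¹' F)) :=
    isOpenMap_proj _ (by rw [h2]; exact hU.sdiff h1)
  convert h3.isClosed_compl.preimage continuous_subtype_val using 1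
  ext ⟨q, u, hu, rfl⟩
  simp only [Set.mem_preimage, Set.mem_compl_iff]
  constructor
  · rintro hq ⟨w, hw, hwq⟩
    exact hw.2 (by rw [Set.mem_preimage, hwq]; exact hq)
  · intro hq
    by_contra h
    exact hq ⟨u, ⟨hu, h⟩, rfl⟩

theorem IsFlatGroup.isStrictlyCausal [FiniteDimensional ℝ V] (hΓ : M.IsFlatGroup Γ)
    (h1 : ∀ γ ∈ Γ, ∀ v, γ v - v ∈ M.cone → γ = 1)
    (h2 : ∀ v, ∃ U ∈ 𝓝 v, {γ | γ ∈ Γ ∧ ∃ y ∈ U, 0 ≤ M.form (y - γ v) (y - γ v)}.Finite) :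
    M.IsStrictlyCausal Γ := by
  refine ⟨hΓ.isCausal h1, fun p => ?_⟩
  obtain ⟨v, rfl⟩ := proj_surjective p
  obtain ⟨U, hU, hfin⟩ := h2 v
  refine ⟨FlatQuotient.proj Γ '' interior U,
    isOpenMap_proj.image_mem_nhds (interior_mem_nhds.mpr hU), ?_, ?_⟩
  · refine isClosed_preimage_of_finite isOpen_interior M.isClosed_cone
      (fun y => hΓ.proj_mem_future_iff) (hfin.subset ?_)
    rintro γ ⟨hγ, y, hy, h⟩
    exact ⟨hγ, y, interior_subset hy, M.form_self_nonneg h⟩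
  · refine isClosed_preimage_of_finite isOpen_interior (M.isClosed_cone.preimage continuous_neg)
      (fun y => hΓ.proj_mem_past_iff) (hfin.subset ?_)
    rintro γ ⟨hγ, y, hy, h⟩
    refine ⟨hγ, y, interior_subset hy, ?_⟩
    have h3 : 0 ≤ M.form (-(y - γ v)) (-(y - γ v)) := M.form_self_nonneg h
    rwa [map_neg, map_neg, LinearMap.neg_apply, neg_neg] at h3

end Causality

end Minkowski

/-! ### Groups of both types are free, proper and strictly causal -/

theorem IsUniformLattice.finite_norm_le {E : Type*} [NormedAddCommGroup E] [NormedSpace ℝ E]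
    [FiniteDimensional ℝ E] {Λ : AddSubgroup E} (h : IsUniformLattice Λ) (R : ℝ) :
    {x | x ∈ Λ ∧ ‖x‖ ≤ R}.Finite := by
  have := h.discrete
  have : IsClosed (Λ : Set E) := AddSubgroup.isClosed_of_discrete
  refine (Metric.finite_isBounded_inter_isClosed (s := (Λ : Set E))
    (DiscreteTopology.isDiscrete) (Metric.isBounded_closedBall (x := (0 : E)) (r := R))
    this).subset ?_
  rintro x ⟨hx, hR⟩
  exact ⟨by simpa using hR, hx⟩

namespace Minkowski

variable {V : Type*} [NormedAddCommGroup V] [NormedSpace ℝ V] [FiniteDimensional ℝ V]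
  {M : Minkowski V}

omit [FiniteDimensional ℝ V] in
theorem properlyDiscontinuousSMul_of_bound {E : Type*} [NormedAddCommGroup E] [NormedSpace ℝ E]
    [FiniteDimensional ℝ E] {Λ : AddSubgroup E} (h : IsUniformLattice Λ)
    {Γ : Subgroup (V ≃ᵃ[ℝ] V)} (φ : E → V ≃ᵃ[ℝ] V) (hφ : ∀ γ ∈ Γ, ∃ x ∈ Λ, φ x = γ)
    (hb : ∀ K : ℝ, ∃ R, ∀ x v, ‖v‖ ≤ K → ‖φ x v‖ ≤ K → ‖x‖ ≤ R) :
    ProperlyDiscontinuousSMul Γ V := by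
  refine ⟨fun {K L} hK hL => ?_⟩
  obtain ⟨k, hk⟩ := (hK.union hL).isBounded.exists_norm_le
  obtain ⟨R, hR⟩ := hb k
  refine Set.Finite.of_finite_image (f := Subtype.val)
    (((h.finite_norm_le R).image φ).subset ?_) Subtype.val_injective.injOn
  rintro _ ⟨⟨γ, hγ⟩, ⟨_, ⟨v, hv, rfl⟩, hw⟩, rfl⟩
  obtain ⟨x, hx, rfl⟩ := hφ γ hγ
  exact ⟨x, ⟨hx, hR x v (hk v (Or.inl hv)) (hk _ (Or.inr hw))⟩, rfl⟩

namespace EllipticData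

variable (D : M.EllipticData)

omit [FiniteDimensional ℝ V] in
theorem mem_group_iff {γ : V ≃ᵃ[ℝ] V} :
    γ ∈ D.group ↔ ∃ x ∈ D.Λ, AffineEquiv.constVAdd ℝ V (x : V) = γ := by
  constructor
  · rintro ⟨_, ⟨x, hx, rfl⟩, rfl⟩
    exact ⟨x, hx, rfl⟩
  · rintro ⟨x, hx, rfl⟩
    exact ⟨_, ⟨x, hx, rfl⟩, rfl⟩

omit [FiniteDimensional ℝ V] in
theorem form_self_neg {x : V} (hx : x ∈ D.T) (h0 : x ≠ 0) : M.form x x < 0 := by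
  by_contra h
  rcases M.mem_cone_or_neg_mem_cone (not_lt.mp h) with h1 | h1
  · exact h0 (D.spacelike.subset ⟨hx, h1⟩)
  · exact h0 (neg_eq_zero.mp (D.spacelike.subset ⟨D.T.neg_mem hx, h1⟩))

theorem isFlatGroup : M.IsFlatGroup D.group where
  form_eq γ hγ v w := by
    obtain ⟨x, -, rfl⟩ := D.mem_group_iff.mp hγ
    rfl
  cone_eq γ hγ := by
    obtain ⟨x, -, rfl⟩ := D.mem_group_iff.mp hγ
    exact Set.image_id _
  free γ hγ v hv := by
    obtain ⟨x, -, rfl⟩ := D.mem_group_iff.mp hγ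
    have h1 : (x : V) + v = v := hv
    rw [add_eq_right.mp h1, AffineEquiv.constVAdd_zero]
    rfl
  proper := by
    refine properlyDiscontinuousSMul_of_bound D.lattice
      (fun x => AffineEquiv.constVAdd ℝ V (x : V)) (fun γ hγ => D.mem_group_iff.mp hγ)
      fun K => ⟨K + K, fun x v hv hw => ?_⟩
    have h1 : ‖(x : V)‖ ≤ ‖(x : V) + v‖ + ‖v‖ := by
      simpa using norm_sub_le ((x : V) + v) v
    exact h1.trans (add_le_add hw hv)

theorem isStrictlyCausal : M.IsStrictlyCausal D.group := by
  refine D.isFlatGroup.isStrictlyCausal (fun γ hγ v h => ?_) fun v => ?_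
  · obtain ⟨x, -, rfl⟩ := D.mem_group_iff.mp hγ
    have h1 : (x : V) + v - v ∈ M.cone := h
    rw [add_sub_cancel_right] at h1
    have h2 : (x : V) = 0 := D.spacelike.subset ⟨x.2, h1⟩
    rw [h2, AffineEquiv.constVAdd_zero]
    rfl
  obtain ⟨K, hK, hform⟩ := M.exists_form_le
  obtain ⟨c, hc, hneg⟩ := M.exists_form_self_le D.T fun w hw h0 => D.form_self_neg hw h0
  -- For ‖x‖ > 1 the square of y − v − x is at most (3Kδ − c)‖x‖², which is negative as 4Kδ ≤ c.
  -- Only the finitely many x with ‖x‖ ≤ 1 remain.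
  set δ : ℝ := min 1 (c / (4 * K)) with hδ
  have hδ0 : 0 < δ := by positivity
  have hδc : δ * (4 * K) ≤ c := by
    rw [← le_div_iff₀ (by positivity)]; exact min_le_right _ _
  refine ⟨Metric.ball v δ, Metric.ball_mem_nhds v hδ0,
    ((D.lattice.finite_norm_le 1).image fun x : D.T => AffineEquiv.constVAdd ℝ V (x : V)).subset ?_⟩
  rintro γ ⟨hγ, y, hy, hq⟩
  obtain ⟨x, hx, rfl⟩ := D.mem_group_iff.mp hγ
  refine ⟨x, ⟨hx, ?_⟩, rfl⟩
  by_contra hx1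
  rw [not_le] at hx1
  have hx2 : 1 < ‖(x : V)‖ := hx1
  have hd : ‖y - v‖ < δ := by simpa [dist_eq_norm] using hy
  have h1 : M.form (y - v - x) (y - v - x) =
      M.form (y - v) (y - v) - 2 * M.form (y - v) x + M.form (x : V) x := M.form_sub_self _ _
  have h2 : 0 ≤ M.form (y - v - x) (y - v - x) := by
    have : y - AffineEquiv.constVAdd ℝ V (x : V) v = y - v - x := by
      change y - ((x : V) + v) = _; abel
    rwa [this] at hq
  have h3 := le_of_abs_le (hform (y - v) (y - v))
  have h4 := neg_le_of_abs_le (hform (y - v) x)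
  have h5 := hneg x x.2
  have h6 : δ ≤ 1 := min_le_left _ _
  have h7 : K * ‖y - v‖ * ‖y - v‖ ≤ K * δ * ‖(x : V)‖ ^ 2 := by
    have : ‖y - v‖ ≤ ‖(x : V)‖ ^ 2 := by nlinarith
    gcongr
  have h8 : K * ‖y - v‖ * ‖(x : V)‖ ≤ K * δ * ‖(x : V)‖ ^ 2 := by
    have : ‖(x : V)‖ ≤ ‖(x : V)‖ ^ 2 := by nlinarith
    gcongr
  nlinarith [sq_pos_of_pos (zero_lt_one.trans hx2)]

end EllipticData

omit [FiniteDimensional ℝ V] in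
theorem mem_transverse {v₀ v₁ v : V} :
    v ∈ M.transverse v₀ v₁ ↔ M.form v₀ v = 0 ∧ M.form v₁ v = 0 := Iff.rfl

namespace ParabolicData

variable (D : M.ParabolicData)

theorem isNullFrame : M.IsNullFrame D.v₀ D.v₁ :=
  isNullFrame_of_mem_frontier D.v₀_mem D.v₁_mem D.form_v₀_v₁

omit [FiniteDimensional ℝ V] in
theorem form_v₀_coe (x : D.T) : M.form D.v₀ (x : V) = 0 := (D.T_le x.2).1

omit [FiniteDimensional ℝ V] in
theorem form_v₀_a (x : D.T) : M.form D.v₀ (D.a x : V) = 0 := (D.a x).2.1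

theorem gamma_apply (x : D.T) (v : V) :
    D.gamma x v = M.parabolicMap D.v₀ (D.a x) x v := rfl

theorem gamma_add (x y : D.T) (v : V) : D.gamma (x + y) v = D.gamma x (D.gamma y v) := by
  change D.gammaHom (Multiplicative.ofAdd x * Multiplicative.ofAdd y) v = _
  rw [map_mul]; rfl

theorem gamma_zero : D.gamma 0 = 1 := D.gammaHom.map_one

theorem mem_group_iff {γ : V ≃ᵃ[ℝ] V} : γ ∈ D.group ↔ ∃ x ∈ D.Λ, D.gamma x = γ := Iff.rfl

/-- `x ↦ x + s a x`. -/
noncomputable def pencil (s : ℝ) : D.T →ₗ[ℝ] M.transverse D.v₀ D.v₁ :=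
  Submodule.inclusion D.T_le + s • D.a

omit [FiniteDimensional ℝ V] in
theorem coe_pencil (s : ℝ) (x : D.T) : (D.pencil s x : V) = s • (D.a x : V) + x := by
  rw [add_comm]; rfl

omit [FiniteDimensional ℝ V] in
theorem pencil_injective {D : M.ParabolicData} (hD : D.KerTrivial) (s : ℝ) :
    Function.Injective (D.pencil s) := LinearMap.ker_eq_bot.mp (hD s)

theorem gamma_sub_self (x : D.T) (v : V) : D.gamma x v - v =
    D.pencil (M.form D.v₀ v) x -
      (M.form v (D.a x : V) + 1 / 2 * M.form D.v₀ v * M.form (D.a x : V) (D.a x : V) +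
        1 / 2 * M.form (D.a x : V) x) • D.v₀ := by
  rw [gamma_apply, parabolicMap_sub_self, coe_pencil]

/-- The v₀-term of the displacement disappears under the projection to N. What is left is a
translation by (1 + sa)x with s = ℓ(v₀,v) constant on orbits, and this is where (*) acts. -/
theorem nproj_gamma (x : D.T) (v : V) : M.nproj D.v₀ D.v₁ (D.gamma x v) =
    M.nproj D.v₀ D.v₁ v + D.pencil (M.form D.v₀ v) x := by
  have h := D.isNullFrame
  have h1 := congrArg (M.nproj D.v₀ D.v₁) (D.gamma_sub_self x v)
  have h2 : ∀ n : M.transverse D.v₀ D.v₁, M.nproj D.v₀ D.v₁ n = n := fun n => by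
    rw [nproj_apply, n.2.1, n.2.2]; simp
  have h3 : M.nproj D.v₀ D.v₁ D.v₀ = 0 := by
    rw [nproj_apply, h.self₀, h.swap.form_eq]; simp
  rw [map_sub, map_sub, map_smul, h2, h3, smul_zero, sub_zero] at h1
  rw [← h1]; abel

/-- (*) gives injectivity for each s; compactness of [−S,S] times the unit sphere makes it uniform.
-/
theorem exists_pencil_ge {D : M.ParabolicData} (hD : D.KerTrivial) (S : ℝ) :
    ∃ m, 0 < m ∧ ∀ s, |s| ≤ S → ∀ x : D.T, m * ‖x‖ ≤ ‖(D.pencil s x : V)‖ := by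
  have hcont : Continuous fun p : ℝ × D.T => ‖(D.pencil p.1 p.2 : V)‖ := by
    simp only [coe_pencil]
    have h1 : Continuous fun x : D.T => (D.a x : V) :=
      continuous_subtype_val.comp (LinearMap.continuous_of_finiteDimensional D.a)
    exact (((continuous_fst.smul (h1.comp continuous_snd))).add
      (continuous_subtype_val.comp continuous_snd)).norm
  have hcpt : IsCompact (Set.Icc (-S) S ×ˢ Metric.sphere (0 : D.T) 1) :=
    isCompact_Icc.prod (isCompact_sphere _ _)
  rcases (Set.Icc (-S) S ×ˢ Metric.sphere (0 : D.T) 1).eq_empty_or_nonempty with he | he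
  · refine ⟨1, one_pos, fun s hs x => ?_⟩
    have : x = 0 := by
      by_contra h0
      have h1 : ((s, ‖x‖⁻¹ • x) : ℝ × D.T) ∈ Set.Icc (-S) S ×ˢ Metric.sphere (0 : D.T) 1 := by
        refine ⟨abs_le.mp hs, ?_⟩
        simp [norm_smul, h0]
      rw [he] at h1
      exact h1
    simp [this]
  obtain ⟨⟨t, u⟩, ⟨ht, hu⟩, hmin⟩ := hcpt.exists_isMinOn he hcont.continuousOn
  have hu0 : u ≠ 0 := by
    rintro rfl
    simp at hu
  refine ⟨‖(D.pencil t u : V)‖, ?_, fun s hs x => ?_⟩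
  · rw [norm_pos_iff]
    intro h0
    exact hu0 (pencil_injective hD t (by rw [map_zero]; ext; exact h0))
  by_cases h0 : x = 0
  · simp [h0]
  have h1 : ((s, ‖x‖⁻¹ • x) : ℝ × D.T) ∈ Set.Icc (-S) S ×ˢ Metric.sphere (0 : D.T) 1 := by
    refine ⟨abs_le.mp hs, ?_⟩
    simp [norm_smul, h0]
  have h2 : ‖(D.pencil t u : V)‖ ≤ ‖(D.pencil s (‖x‖⁻¹ • x) : V)‖ := hmin h1
  rw [map_smul, Submodule.coe_smul, norm_smul, norm_inv, norm_norm, inv_mul_eq_div,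
    le_div_iff₀ (norm_pos_iff.mpr h0)] at h2
  exact h2

theorem isFlatGroup {D : M.ParabolicData} (hD : D.KerTrivial) : M.IsFlatGroup D.group where
  form_eq γ hγ v w := by
    obtain ⟨x, -, rfl⟩ := D.mem_group_iff.mp hγ
    exact form_nu_nu D.isNullFrame.self₀ (D.form_v₀_a x) v w
  cone_eq γ hγ := by
    obtain ⟨x, -, rfl⟩ := D.mem_group_iff.mp hγ
    refine Set.Subset.antisymm ?_ fun c hc => ?_
    · rintro _ ⟨c, hc, rfl⟩
      exact D.isNullFrame.nu_mem_cone (D.form_v₀_a x) hc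
    · refine ⟨D.lam (-x) c, D.isNullFrame.nu_mem_cone (D.form_v₀_a (-x)) hc, ?_⟩
      change D.lam x (D.lam (-x) c) = c
      rw [← lam_add_apply, add_neg_cancel, lam_zero_apply]
  free γ hγ v hv := by
    obtain ⟨x, -, rfl⟩ := D.mem_group_iff.mp hγ
    have h1 := D.nproj_gamma x v
    rw [hv] at h1
    have h2 : D.pencil (M.form D.v₀ v) x = 0 := by
      ext; exact left_eq_add.mp h1
    rw [pencil_injective hD _ (h2.trans (map_zero _).symm), gamma_zero]
  proper := by
    let P : V →L[ℝ] V := LinearMap.toContinuousLinearMap (M.nproj D.v₀ D.v₁)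
    obtain ⟨k, hk, hform⟩ := M.exists_form_le
    refine properlyDiscontinuousSMul_of_bound D.lattice D.gamma (fun γ hγ => hγ) fun K => ?_
    obtain ⟨m, hm, hpen⟩ := exists_pencil_ge hD (k * ‖D.v₀‖ * K)
    refine ⟨(‖P‖ * K + ‖P‖ * K) / m, fun x v hv hw => ?_⟩
    have hs : |M.form D.v₀ v| ≤ k * ‖D.v₀‖ * K := (hform _ _).trans (by gcongr)
    have h1 : (D.pencil (M.form D.v₀ v) x : V) = P (D.gamma x v) - P v :=
      eq_sub_of_add_eq' (D.nproj_gamma x v).symm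
    have h2 := hpen _ hs x
    rw [h1] at h2
    rw [le_div_iff₀ hm, mul_comm]
    refine h2.trans ((norm_sub_le _ _).trans ?_)
    exact add_le_add ((P.le_opNorm _).trans (by gcongr)) ((P.le_opNorm _).trans (by gcongr))

theorem isStrictlyCausal {D : M.ParabolicData} (hD : D.KerTrivial) :
    M.IsStrictlyCausal D.group := by
  have h := D.isNullFrame
  refine (isFlatGroup hD).isStrictlyCausal (fun γ hγ v hc => ?_) fun v => ?_
  · obtain ⟨x, -, rfl⟩ := D.mem_group_iff.mp hγ
    have h1 := M.form_self_nonneg hc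
    have h2 := (D.pencil (M.form D.v₀ v) x).2
    rw [gamma_sub_self, form_smul_add_sub_smul h.self₀ h2.1] at h1
    have h3 : D.pencil (M.form D.v₀ v) x = 0 := by
      by_contra h0
      linarith [h.form_self_neg h2.1 h2.2 (by simpa using h0)]
    rw [pencil_injective hD _ (h3.trans (map_zero _).symm), gamma_zero]
  let P : V →L[ℝ] V := LinearMap.toContinuousLinearMap (M.nproj D.v₀ D.v₁)
  let A : D.T →L[ℝ] V :=
    LinearMap.toContinuousLinearMap ((M.transverse D.v₀ D.v₁).subtype ∘ₗ D.a)
  obtain ⟨k, hk, hform⟩ := M.exists_form_le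
  obtain ⟨c, hc, hneg⟩ := M.exists_form_self_le (M.transverse D.v₀ D.v₁)
    fun w hw h0 => h.form_self_neg hw.1 hw.2 h0
  set s := M.form D.v₀ v with hs
  obtain ⟨m, hm, hpen⟩ := exists_pencil_ge hD |s|
  set p := ‖P‖ + 1 with hp
  have hp0 : 0 < p := by positivity
  have hv0 : 0 < ‖D.v₀‖ := norm_pos_iff.mpr h.ne_zero
  set k₀ := k * ‖D.v₀‖ with hk₀
  set k₁ := k * ‖D.v₁‖ + (k * ‖v‖ * ‖A‖ + |s| * (k * ‖A‖ * ‖A‖) + k * ‖A‖ + 1) with hk₁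
  have hk₀0 : 0 < k₀ := by positivity
  have hk₁0 : 0 < k₁ := by positivity
  -- Put z = y − γ_x v and X = ‖x‖ > 1. Then |ℓ(v₀,z)| ≤ k₀δ because ℓ(v₀,·) is invariant, |ℓ(v₁,z)|
  -- ≤ k₁X², and the N-component of z has norm at least mX/2. Hence ℓ(z,z) ≤ (2k₀k₁δ − cm²/4)X², and
  -- this δ makes the bracket negative.
  set δ : ℝ := min 1 (min (m / (2 * p)) (c * m ^ 2 / (16 * k₀ * k₁))) with hδ
  have hδ0 : 0 < δ := by positivity
  have hδ1 : δ ≤ 1 := min_le_left _ _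
  have hδ2 : δ * (2 * p) ≤ m := by
    rw [← le_div_iff₀ (by positivity)]; exact (min_le_right _ _).trans (min_le_left _ _)
  have hδ3 : δ * (16 * k₀ * k₁) ≤ c * m ^ 2 := by
    rw [← le_div_iff₀ (by positivity)]; exact (min_le_right _ _).trans (min_le_right _ _)
  refine ⟨Metric.ball v δ, Metric.ball_mem_nhds v hδ0,
    ((D.lattice.finite_norm_le 1).image D.gamma).subset ?_⟩
  rintro γ ⟨hγ, y, hy, hq⟩
  obtain ⟨x, hx, rfl⟩ := D.mem_group_iff.mp hγ
  refine ⟨x, ⟨hx, ?_⟩, rfl⟩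
  by_contra hx1
  rw [not_le] at hx1
  have hd : ‖y - v‖ < δ := by simpa [dist_eq_norm] using hy
  set X := ‖x‖ with hX
  set B := M.form v (D.a x : V) + 1 / 2 * s * M.form (D.a x : V) (D.a x : V) +
    1 / 2 * M.form (D.a x : V) x with hB
  have hz : y - D.gamma x v = (y - v) - D.pencil s x + B • D.v₀ := by
    have := D.gamma_sub_self x v
    rw [← hs, ← hB] at this
    rw [sub_add, ← this]; abel
  have hz0 : M.form D.v₀ (y - D.gamma x v) = M.form D.v₀ (y - v) := by
    rw [hz, map_add, map_sub, (D.pencil s x).2.1, map_smul, h.self₀]; simp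
  have hz1 : M.form D.v₁ (y - D.gamma x v) = M.form D.v₁ (y - v) + B := by
    rw [hz, map_add, map_sub, (D.pencil s x).2.2, map_smul, h.swap.form_eq]; simp
  have hzn : M.nproj D.v₀ D.v₁ (y - D.gamma x v) = P (y - v) - D.pencil s x := by
    rw [map_sub, nproj_gamma, ← hs, ← sub_sub, ← map_sub]; rfl
  have ha : ‖(D.a x : V)‖ ≤ ‖A‖ * X := A.le_opNorm x
  have hX2 : X ≤ X ^ 2 := by nlinarith
  have hX1 : 1 ≤ X ^ 2 := by nlinarith
  have e0 : |M.form D.v₀ (y - v)| ≤ k₀ * δ := (hform _ _).trans (by gcongr)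
  have e1 : |M.form D.v₁ (y - v)| ≤ k * ‖D.v₁‖ * X ^ 2 := (hform _ _).trans (by
    gcongr; linarith)
  have e2 : |M.form v (D.a x : V)| ≤ k * ‖v‖ * ‖A‖ * X ^ 2 := (hform _ _).trans (by
    calc k * ‖v‖ * ‖(D.a x : V)‖ ≤ k * ‖v‖ * (‖A‖ * X) := by gcongr
      _ ≤ k * ‖v‖ * (‖A‖ * X ^ 2) := by gcongr
      _ = _ := by ring)
  have e3 : |M.form (D.a x : V) (D.a x : V)| ≤ k * ‖A‖ * ‖A‖ * X ^ 2 := (hform _ _).trans (by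
    calc k * ‖(D.a x : V)‖ * ‖(D.a x : V)‖ ≤ k * (‖A‖ * X) * (‖A‖ * X) := by gcongr
      _ = _ := by ring)
  have e4 : |M.form (D.a x : V) x| ≤ k * ‖A‖ * X ^ 2 := (hform _ _).trans (by
    calc k * ‖(D.a x : V)‖ * X ≤ k * (‖A‖ * X) * X := by gcongr
      _ = _ := by ring)
  have e5 : |1 / 2 * s * M.form (D.a x : V) (D.a x : V)| ≤
      |s| * (k * ‖A‖ * ‖A‖) * X ^ 2 := by
    rw [abs_mul, abs_mul]
    calc |(1 / 2 : ℝ)| * |s| * |M.form (D.a x : V) (D.a x : V)|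
        ≤ 1 * |s| * (k * ‖A‖ * ‖A‖ * X ^ 2) := by
          gcongr
          rw [abs_of_pos] <;> norm_num
      _ = _ := by ring
  have e6 : |1 / 2 * M.form (D.a x : V) x| ≤ k * ‖A‖ * X ^ 2 := by
    rw [abs_mul, abs_of_pos (by norm_num : (0 : ℝ) < 1 / 2)]
    linarith [abs_nonneg (M.form (D.a x : V) x)]
  have e7 : |M.form D.v₁ (y - v) + B| ≤ k₁ * X ^ 2 := by
    rw [hB]
    refine (abs_add_le _ _).trans ?_
    have h1 := (abs_add_three (M.form v (D.a x : V))
      (1 / 2 * s * M.form (D.a x : V) (D.a x : V)) (1 / 2 * M.form (D.a x : V) x))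
    have h2 : 0 ≤ X ^ 2 := sq_nonneg X
    rw [hk₁]
    linarith
  have e8 : m / 2 * X ≤ ‖P (y - v) - D.pencil s x‖ := by
    have h1 : ‖P (y - v)‖ ≤ p * δ := by
      refine (P.le_opNorm _).trans ?_
      gcongr
      rw [hp]; linarith
    have h2 := hpen s le_rfl x
    have h3 := norm_sub_norm_le (D.pencil s x : V) (P (y - v))
    rw [norm_sub_rev] at h3
    have h4 : m ≤ m * X := le_mul_of_one_le_right hm.le hx1.le
    linarith
  have hqz := h.form_self (y - D.gamma x v)
  rw [hz0, hz1, hzn] at hqz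
  have e9 := hneg (P (y - v) - D.pencil s x)
    (Submodule.sub_mem _ ⟨h.form_nproj₀ _, h.form_nproj₁ _⟩ (D.pencil s x).2)
  have e10 : (m / 2 * X) ^ 2 ≤ ‖P (y - v) - D.pencil s x‖ ^ 2 := by gcongr
  have e11 : M.form D.v₀ (y - v) * (M.form D.v₁ (y - v) + B) ≤ (k₀ * δ) * (k₁ * X ^ 2) := by
    refine (le_abs_self _).trans ?_
    rw [abs_mul]
    gcongr
  have e12 : 0 < c * m ^ 2 * X ^ 2 := by positivity
  have e13 := mul_le_mul_of_nonneg_left e10 hc.le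
  have e14 := mul_le_mul_of_nonneg_right hδ3 (sq_nonneg X)
  linarith

end ParabolicData

end Minkowski

/-! ### Trivializing a family of injective linear maps over the line -/

section Trivialization

variable {E F : Type*} [NormedAddCommGroup E] [NormedSpace ℝ E]
  [NormedAddCommGroup F] [NormedSpace ℝ F] [FiniteDimensional ℝ F]

/-- Over the segment `[b,c]`, the family `A` is obtained from `A b` by a continuous family of
automorphisms of the target. -/
def TrivialOn (A : ℝ → E →L[ℝ] F) (b c : ℝ) : Prop :=
  ∃ B : ℝ → (F →L[ℝ] F)ˣ, Continuous B ∧ (∀ s ≤ b, B s = 1) ∧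
    ∀ s, b ≤ s → s ≤ c → ∀ x, (B s : F →L[ℝ] F) (A b x) = A s x

variable {A : ℝ → E →L[ℝ] F}

omit [FiniteDimensional ℝ F] in
theorem TrivialOn.refl (b : ℝ) : TrivialOn A b b :=
  ⟨fun _ => 1, continuous_const, fun _ _ => rfl, fun s h1 h2 x => by
    rw [le_antisymm h2 h1]; rfl⟩

omit [FiniteDimensional ℝ F] in
-- Evaluating the first family at min s c freezes it beyond c, while the second family is 1 up to c.
theorem TrivialOn.trans {b c d : ℝ} (h₁ : TrivialOn A b c) (h₂ : TrivialOn A c d) (hbc : b ≤ c) :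
    TrivialOn A b d := by
  obtain ⟨B, hB, hB1, hBA⟩ := h₁
  obtain ⟨C, hC, hC1, hCA⟩ := h₂
  refine ⟨fun s => C s * B (min s c), hC.mul (hB.comp (continuous_id.min continuous_const)),
    fun s hs => ?_, fun s h1 h2 x => ?_⟩
  · beta_reduce
    rw [hC1 s (hs.trans hbc), min_eq_left (hs.trans hbc), hB1 s hs, one_mul]
  · rw [Units.val_mul, mul_apply_eq_comp, hBA _ (le_min h1 hbc) (min_le_right _ _)]
    rcases le_total s c with h | h
    · rw [min_eq_left h, hC1 s h]; rfl
    · rw [min_eq_right h, hCA s h h2]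

/-- With L a left inverse of A c, the operator 1 + (A s − A c)L carries A c to A s, and it is
invertible for s near c. -/
theorem exists_nhds_trivialOn (hA : Continuous A) {c : ℝ} (hc : Function.Injective (A c)) :
    ∃ U : Set ℝ, IsOpen U ∧ c ∈ U ∧ ∀ a b, a ≤ b → Set.Icc a b ⊆ U → TrivialOn A a b := by
  obtain ⟨L, hL⟩ := (A c : E →ₗ[ℝ] F).exists_leftInverse_of_injective (LinearMap.ker_eq_bot.mpr hc)
  let L' : F →L[ℝ] E := LinearMap.toContinuousLinearMap L
  have hL' : ∀ x, L' (A c x) = x := fun x => LinearMap.congr_fun hL x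
  let G : ℝ → F →L[ℝ] F := fun s => 1 + (A s - A c) ∘L L'
  have hG : Continuous G := by fun_prop
  have hGA : ∀ s x, G s (A c x) = A s x := fun s x => by simp [G, hL']
  refine ⟨G ⁻¹' {g | IsUnit g}, Units.isOpen.preimage hG, by simp [G], fun a b hab hU => ?_⟩
  have hcl : ∀ s, max a (min s b) ∈ Set.Icc a b := fun s =>
    ⟨le_max_left _ _, max_le hab (min_le_right _ _)⟩
  let u : ℝ → (F →L[ℝ] F)ˣ := fun s => (hU (hcl s)).unit
  have hu : Continuous u := by
    rw [Units.isOpenEmbedding_val.continuous_iff]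
    exact hG.comp (continuous_const.max (continuous_id.min continuous_const))
  refine ⟨fun s => u s * (u a)⁻¹, hu.mul continuous_const, fun s hs => ?_, fun s h1 h2 x => ?_⟩
  · have : u s = u a := by
      simp only [u, min_eq_left (hs.trans hab), max_eq_left hs, min_eq_left hab, max_self]
    beta_reduce
    rw [this, mul_inv_cancel]
  · have h3 : (u a : F →L[ℝ] F) (A c x) = A a x := by
      change G (max a (min a b)) _ = _
      rw [min_eq_left hab, max_self, hGA]
    rw [← h3, ← mul_apply_eq_comp, ← Units.val_mul, inv_mul_cancel_right]
    change G (max a (min s b)) _ = _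
    rw [min_eq_left h2, max_eq_right h1, hGA]

theorem trivialOn_of_injective (hA : Continuous A) (hinj : ∀ s, Function.Injective (A s))
    {a b : ℝ} (hab : a ≤ b) : TrivialOn A a b := by
  choose U hUo hU hUA using fun c => exists_nhds_trivialOn hA (hinj c)
  obtain ⟨t, ht0, htm, ⟨n, hn⟩, ht⟩ := exists_monotone_Icc_subset_open_cover_Icc hab
    (c := fun c : ℝ => (Subtype.val ⁻¹' U c : Set (Set.Icc a b)))
    (fun c => (hUo c).preimage continuous_subtype_val)
    (fun s _ => Set.mem_iUnion.mpr ⟨s, hU s⟩)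
  have key : ∀ k, TrivialOn A a (t k) := by
    intro k
    induction k with
    | zero => rw [ht0]; exact TrivialOn.refl a
    | succ k ih =>
      refine ih.trans ?_ (t k).2.1
      obtain ⟨c, hc⟩ := ht k
      refine hUA c _ _ (htm (Nat.le_succ k)) fun s hs => ?_
      exact hc (show (⟨s, (t k).2.1.trans hs.1, hs.2.trans (t (k + 1)).2.2⟩ : Set.Icc a b) ∈
        Set.Icc (t k) (t (k + 1)) from hs)
  have := key n
  rwa [hn n le_rfl] at this

theorem exists_trivialization_right (hA : Continuous A) (hinj : ∀ s, Function.Injective (A s)) :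
    ∃ B : ℝ → (F →L[ℝ] F)ˣ, Continuous B ∧ (∀ s ≤ 0, B s = 1) ∧
      ∀ s, 0 ≤ s → ∀ x, (B s : F →L[ℝ] F) (A 0 x) = A s x := by
  choose C hC hC1 hCA using fun n : ℕ =>
    trivialOn_of_injective hA hinj (a := n) (b := (n + 1 : ℕ)) (by simp)
  -- Stage n is correct on [0,n], and later stages agree with it for all s ≤ n.
  let B : ℕ → ℝ → (F →L[ℝ] F)ˣ := fun n =>
    Nat.rec (fun _ => 1) (fun n f s => C n s * f (min s n)) n
  have hB0 : ∀ s, B 0 s = 1 := fun _ => rfl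
  have hBs : ∀ n s, B (n + 1) s = C n s * B n (min s n) := fun _ _ => rfl
  have hBc : ∀ n, Continuous (B n) := by
    intro n
    induction n with
    | zero => exact continuous_const
    | succ n ih => exact (hC n).mul (ih.comp (continuous_id.min continuous_const))
  have hBA : ∀ n : ℕ, ∀ s : ℝ, 0 ≤ s → s ≤ n → ∀ x, (B n s).val (A 0 x) = A s x := by
    intro n
    induction n with
    | zero =>
      intro s h0 h1 x
      rw [hB0, le_antisymm (by simpa using h1) h0]; rfl
    | succ n ih =>
      intro s h0 h1 x
      rw [hBs, Units.val_mul, mul_apply_eq_comp,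
        ih _ (le_min h0 n.cast_nonneg) (min_le_right _ _)]
      rcases le_total s n with h | h
      · rw [min_eq_left h, hC1 n s h]; rfl
      · rw [min_eq_right h, hCA n s h h1]
  have hstep : ∀ n : ℕ, ∀ s : ℝ, s ≤ n → B (n + 1) s = B n s := fun n s hs => by
    rw [hBs, hC1 n s hs, min_eq_left hs, one_mul]
  have hstab : ∀ m n : ℕ, n ≤ m → ∀ s : ℝ, s ≤ n → B m s = B n s := by
    intro m n hnm
    induction m, hnm using Nat.le_induction with
    | base => exact fun _ _ => rfl
    | succ m hm ih =>
      intro s hs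
      rw [hstep m s (hs.trans (by exact_mod_cast hm)), ih s hs]
  refine ⟨fun s => B ⌈s⌉₊ s, ?_, fun s hs => ?_, fun s hs x => hBA _ s hs (Nat.le_ceil s) x⟩
  · rw [continuous_iff_continuousAt]
    intro s
    -- The index ⌈s⌉₊ jumps at integers; one stage further agrees with the family on the whole
    -- neighbourhood r < ⌈s⌉₊ + 1.
    refine (hBc (⌈s⌉₊ + 1)).continuousAt.congr ?_
    have : ∀ᶠ r in 𝓝 s, r < ((⌈s⌉₊ + 1 : ℕ) : ℝ) := by
      refine eventually_lt_nhds ?_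
      push_cast
      linarith [Nat.le_ceil s]
    filter_upwards [this] with r hr
    exact hstab _ _ (Nat.ceil_le.mpr hr.le) r (Nat.le_ceil r)
  · simp only [Nat.ceil_eq_zero.mpr hs, hB0]

/-- A continuous family of injective linear mappings, parametrized by `ℝ`, is trivial. -/
theorem exists_trivialization (hA : Continuous A) (hinj : ∀ s, Function.Injective (A s)) :
    ∃ B : ℝ → (F →L[ℝ] F)ˣ, Continuous B ∧ ∀ s x, (B s : F →L[ℝ] F) (A 0 x) = A s x := by
  obtain ⟨B, hB, hB1, hBA⟩ := exists_trivialization_right hA hinj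
  obtain ⟨C, hC, hC1, hCA⟩ := exists_trivialization_right (A := fun s => A (-s))
    (hA.comp continuous_neg) fun s => hinj (-s)
  rw [neg_zero] at hCA
  refine ⟨fun s => B s * C (-s), hB.mul (hC.comp continuous_neg), fun s x => ?_⟩
  beta_reduce
  rcases le_total 0 s with h | h
  · rw [hC1 (-s) (by linarith), mul_one, hBA s h]
  · rw [hB1 s h, one_mul, hCA (-s) (by linarith), neg_neg]

end Trivialization

/-! ### The quotient as torus times vector space -/

namespace Minkowski

variable {V : Type*} [NormedAddCommGroup V] [NormedSpace ℝ V] [FiniteDimensional ℝ V]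

/-- Through Ψ the group becomes Λ acting by translations. Splitting V as T × V/T gives a continuous
open surjection whose fibres are the Γ-orbits. -/
theorem nonempty_homeomorph_of_equivariant {T : Submodule ℝ V} {Λ : AddSubgroup T}
    {Γ : Subgroup (V ≃ᵃ[ℝ] V)} (φ : T → V ≃ᵃ[ℝ] V) (hΓ : ∀ γ, γ ∈ Γ ↔ ∃ x ∈ Λ, φ x = γ)
    (Ψ : V ≃ₜ V) (hΨ : ∀ (x : T) v, Ψ (x + v) = φ x (Ψ v)) :
    Nonempty (FlatQuotient Γ ≃ₜ (T ⧸ Λ) × (V ⧸ T)) := by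
  obtain ⟨P, hP⟩ := T.subtype.exists_leftInverse_of_injective T.ker_subtype
  have hPc : Continuous P := LinearMap.continuous_of_finiteDimensional P
  have hPT : ∀ x : T, P x = x := fun x => LinearMap.congr_fun hP x
  let σ : V ⧸ T →ₗ[ℝ] V := T.liftQ (LinearMap.id - T.subtype ∘ₗ P) (by
    intro x hx
    have := hPT ⟨x, hx⟩
    simp [this])
  have hσ : ∀ v, σ (T.mkQ v) = v - P v := fun v => rfl
  have hσc : Continuous σ :=
    continuous_quot_lift _ (continuous_id.sub (continuous_subtype_val.comp hPc))
  have hPσ : ∀ q, P (σ q) = 0 := by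
    intro q
    obtain ⟨v, rfl⟩ := T.mkQ_surjective q
    rw [hσ, map_sub, hPT, sub_self]
  have hmk : Continuous T.mkQ := continuous_quot_mk
  have hmkT : ∀ x : T, T.mkQ x = 0 := fun x => (Submodule.Quotient.mk_eq_zero T).mpr x.2
  let e : V ≃ₜ T × (V ⧸ T) :=
    { toFun := fun v => (P v, T.mkQ v)
      invFun := fun p => p.1 + σ p.2
      left_inv := fun v => by simp only [hσ, add_sub_cancel]
      right_inv := fun ⟨x, q⟩ => by
        obtain ⟨v, rfl⟩ := T.mkQ_surjective q
        ext1
        · simp only [map_add, hPT, hPσ, add_zero]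
        · simp only [hσ]
          rw [map_add, map_sub, hmkT, hmkT, zero_add, sub_zero]
      continuous_toFun := hPc.prodMk hmk
      continuous_invFun := (continuous_subtype_val.comp continuous_fst).add
        (hσc.comp continuous_snd) }
  let f : V → (T ⧸ Λ) × (V ⧸ T) := fun v =>
    Prod.map (QuotientAddGroup.mk : T → T ⧸ Λ) id (e (Ψ.symm v))
  have hfo : IsOpenMap f :=
    ((QuotientAddGroup.isOpenMap_coe.prodMap IsOpenMap.id).comp e.isOpenMap).comp
      Ψ.symm.isOpenMap
  have hfc : Continuous f :=
    ((QuotientAddGroup.continuous_mk.prodMap continuous_id).comp e.continuous).comp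
      Ψ.symm.continuous
  have hfs : Function.Surjective f := fun ⟨t, q⟩ => by
    obtain ⟨x, rfl⟩ := QuotientAddGroup.mk_surjective t
    exact ⟨Ψ (e.symm (x, q)), by simp [f]⟩
  have hf : ∀ v w, f v = f w ↔ FlatQuotient.proj Γ v = FlatQuotient.proj Γ w := by
    intro v w
    obtain ⟨v, rfl⟩ := Ψ.surjective v
    obtain ⟨w, rfl⟩ := Ψ.surjective w
    rw [proj_eq_proj_iff]
    simp only [f, Homeomorph.symm_apply_apply, Prod.map, Prod.mk.injEq, id]
    constructor
    · rintro ⟨h1, h2⟩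
      rw [eq_comm, QuotientAddGroup.eq] at h1
      refine ⟨φ (-P w + P v), (hΓ _).mpr ⟨_, h1, rfl⟩, ?_⟩
      rw [← hΨ]
      congr 1
      apply e.injective
      ext1
      · change P _ = P _
        rw [map_add, hPT]; abel
      · change T.mkQ _ = T.mkQ _
        rw [map_add]
        rw [hmkT, zero_add]; exact h2.symm
    · rintro ⟨γ, hγ, h⟩
      obtain ⟨x, hx, rfl⟩ := (hΓ _).mp hγ
      rw [← hΨ] at h
      rw [← Ψ.injective h]
      constructor
      · change QuotientAddGroup.mk (P _) = QuotientAddGroup.mk (P _)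
        rw [eq_comm, QuotientAddGroup.eq, map_add, hPT]
        simpa using hx
      · change T.mkQ _ = T.mkQ _
        rw [map_add, hmkT, zero_add]
  let g : FlatQuotient Γ → (T ⧸ Λ) × (V ⧸ T) := Quotient.lift f fun v w h =>
    (hf v w).mpr (Quotient.sound h)
  have hg : ∀ v, g (FlatQuotient.proj Γ v) = f v := fun _ => rfl
  have hbij : Function.Bijective g := by
    constructor
    · intro p q hpq
      obtain ⟨v, rfl⟩ := proj_surjective p
      obtain ⟨w, rfl⟩ := proj_surjective q
      exact (hf v w).mp hpq
    · intro y
      obtain ⟨v, rfl⟩ := hfs y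
      exact ⟨FlatQuotient.proj Γ v, rfl⟩
  have hgc : Continuous g := continuous_quot_lift _ hfc
  have hgo : IsOpenMap g := by
    intro U hU
    have : g '' U = f '' (FlatQuotient.proj Γ ⁻¹' U) := by
      ext y
      constructor
      · rintro ⟨p, hp, rfl⟩
        obtain ⟨v, rfl⟩ := proj_surjective p
        exact ⟨v, hp, rfl⟩
      · rintro ⟨v, hv, rfl⟩
        exact ⟨_, hv, rfl⟩
    rw [this]
    exact hfo _ (hU.preimage continuous_proj)
  exact ⟨(Equiv.ofBijective g hbij).toHomeomorphOfContinuousOpen hgc hgo⟩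

variable {M : Minkowski V}

theorem EllipticData.nonempty_homeomorph (D : M.EllipticData) :
    Nonempty (FlatQuotient D.group ≃ₜ (D.T ⧸ D.Λ) × (V ⧸ D.T)) :=
  nonempty_homeomorph_of_equivariant (fun x => AffineEquiv.constVAdd ℝ V (x : V))
    (fun _ => D.mem_group_iff) (Homeomorph.refl V) fun _ _ => rfl

namespace ParabolicData

theorem continuous_gamma (D : M.ParabolicData) :
    Continuous fun p : D.T × V => D.gamma p.1 p.2 := by
  have h1 : Continuous fun x : D.T => (D.a x : V) :=
    continuous_subtype_val.comp (LinearMap.continuous_of_finiteDimensional D.a)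
  have h2 : Continuous fun p : D.T × V => (D.a p.1 : V) := h1.comp continuous_fst
  have h3 : Continuous fun p : D.T × V => (p.1 : V) := continuous_subtype_val.comp continuous_fst
  have h4 : Continuous fun p : D.T × V => p.2 := continuous_snd
  simp only [gamma_apply, parabolicMap, nu_apply]
  have h5 : Continuous fun p : D.T × V => M.form D.v₀ p.2 := continuous_const.minkowski_form h4
  exact ((h4.add (h5.smul h2)).sub (((h4.minkowski_form h2).add
    ((continuous_const.mul h5).mul (h2.minkowski_form h2))).smul continuous_const)).add
    (h3.sub ((continuous_const.mul (h2.minkowski_form h3)).smul continuous_const))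

theorem form_v₀_gamma (D : M.ParabolicData) (x : D.T) (v : V) :
    M.form D.v₀ (D.gamma x v) = M.form D.v₀ v :=
  form_parabolicMap D.isNullFrame.self₀ (D.form_v₀_a x) (D.form_v₀_coe x) v

/-- A homeomorphism that conjugates the translations by `T` to the action of `T`. -/
theorem exists_equivariant_homeomorph {D : M.ParabolicData} (hD : D.KerTrivial) :
    ∃ Ψ : V ≃ₜ V, ∀ (x : D.T) v, Ψ (x + v) = D.gamma x (Ψ v) := by
  have h := D.isNullFrame
  let N := M.transverse D.v₀ D.v₁
  let i : D.T →L[ℝ] N := LinearMap.toContinuousLinearMap (Submodule.inclusion D.T_le)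
  let a : D.T →L[ℝ] N := LinearMap.toContinuousLinearMap D.a
  obtain ⟨B, hB, hBA⟩ := exists_trivialization (A := fun s => i + s • a) (by fun_prop)
    (fun s => pencil_injective hD s)
  have hBA' : ∀ s (x : D.T), (B s : N →L[ℝ] N) (i x) = D.pencil s x := fun s x => by
    have := hBA s x
    rwa [zero_smul ℝ a, add_zero] at this
  let n : V →ₗ[ℝ] N := (M.nproj D.v₀ D.v₁).codRestrict N
    fun v => ⟨h.form_nproj₀ v, h.form_nproj₁ v⟩
  have hnc : Continuous n := LinearMap.continuous_of_finiteDimensional n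
  have hn : ∀ y : N, n y = y := fun y => by
    ext; change M.nproj D.v₀ D.v₁ y = y; rw [nproj_apply, y.2.1, y.2.2]; simp
  have hnγ : ∀ x v, n (D.gamma x v) = n v + D.pencil (M.form D.v₀ v) x := fun x v => by
    ext; exact D.nproj_gamma x v
  have hni : ∀ x : D.T, n x = i x := fun x => hn (i x)
  obtain ⟨P, hP⟩ := (Submodule.inclusion D.T_le).exists_leftInverse_of_injective
    (Submodule.ker_inclusion _ _ _)
  have hPi : ∀ x, P (i x) = x := fun x => LinearMap.congr_fun hP x
  have hPc : Continuous P := LinearMap.continuous_of_finiteDimensional P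
  let l : V → ℝ := fun v => M.form D.v₀ v
  have hl : Continuous l := continuous_const.minkowski_form continuous_id
  -- Φ B applies B(ℓ(v₀,v)) to the N-component and leaves the products with v₀ and v₁ unchanged.
  let Φ : (ℝ → (N →L[ℝ] N)ˣ) → V → V := fun B v =>
    v + (((B (l v) : N →L[ℝ] N) (n v) : N) - (n v : N) : V)
  have hΦl : ∀ B v, l (Φ B v) = l v := fun B v => by
    change M.form D.v₀ _ = M.form D.v₀ v
    have h1 : ∀ y : N, M.form D.v₀ (y : V) = 0 := fun y => y.2.1
    simp only [Φ, map_add, map_sub, h1, sub_zero, add_zero]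
  have hΦn : ∀ B v, n (Φ B v) = (B (l v) : N →L[ℝ] N) (n v) := fun B v => by
    simp only [Φ, map_add, map_sub, hn]; abel
  have hΦc : ∀ B, Continuous B → Continuous (Φ B) := fun B hB => by
    have h1 : Continuous fun v => (B (l v) : N →L[ℝ] N) :=
      Units.continuous_val.comp (hB.comp hl)
    exact continuous_id.add ((continuous_subtype_val.comp (h1.clm_apply hnc)).sub
      (continuous_subtype_val.comp hnc))
  let C : ℝ → (N →L[ℝ] N)ˣ := fun s => (B s)⁻¹
  have hC : Continuous C := hB.inv
  have hCB : ∀ s y, (C s : N →L[ℝ] N) ((B s : N →L[ℝ] N) y) = y := fun s y => by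
    rw [← mul_apply_eq_comp, ← Units.val_mul, inv_mul_cancel]; rfl
  have hBC : ∀ s y, (B s : N →L[ℝ] N) ((C s : N →L[ℝ] N) y) = y := fun s y => by
    rw [← mul_apply_eq_comp, ← Units.val_mul, mul_inv_cancel]; rfl
  have hΦΦ : ∀ v, Φ C (Φ B v) = v := fun v => by
    change Φ B v + (((C (l (Φ B v)) : N →L[ℝ] N) (n (Φ B v)) : N) - (n (Φ B v) : N) : V) = v
    rw [hΦl, hΦn, hCB]
    simp only [Φ]; abel
  have hΦΦ' : ∀ v, Φ B (Φ C v) = v := fun v => by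
    change Φ C v + (((B (l (Φ C v)) : N →L[ℝ] N) (n (Φ C v)) : N) - (n (Φ C v) : N) : V) = v
    rw [hΦl, hΦn, hBC]
    simp only [Φ]; abel
  have hlT : ∀ (x : D.T) v, l (v + x) = l v := fun x v => by
    change M.form D.v₀ _ = M.form D.v₀ v
    rw [map_add, D.form_v₀_coe, add_zero]
  have hlT' : ∀ (x : D.T) v, l (v - x) = l v := fun x v => by
    change M.form D.v₀ _ = M.form D.v₀ v
    rw [map_sub, D.form_v₀_coe, sub_zero]
  have hγ1 : ∀ x v, D.gamma x (D.gamma (-x) v) = v := fun x v => by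
    rw [← gamma_add, add_neg_cancel, gamma_zero]; rfl
  have hγ2 : ∀ x v, D.gamma (-x) (D.gamma x v) = v := fun x v => by
    rw [← gamma_add, neg_add_cancel, gamma_zero]; rfl
  -- Φ B intertwines translations with the action only in the N-component, not in the v₀-coordinate.
  -- It is therefore used on the slice X = 0 and extended by equivariance; Y recovers X(v) from
  -- Ψ(v).
  let X : V → D.T := fun v => P (n v)
  let Y : V → D.T := fun v => P ((C (l v) : N →L[ℝ] N) (n v))
  have hXc : Continuous X := hPc.comp hnc
  have hYc : Continuous Y :=
    hPc.comp ((Units.continuous_val.comp (hC.comp hl)).clm_apply hnc)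
  let Ψ : V → V := fun v => D.gamma (X v) (Φ B (v - X v))
  let Ψ' : V → V := fun v => Φ C (D.gamma (-Y v) v) + Y v
  have hΨl : ∀ v, l (Ψ v) = l v := fun v => by
    change M.form D.v₀ _ = _
    rw [form_v₀_gamma]
    exact (hΦl _ _).trans (hlT' _ _)
  have hΨn : ∀ v, n (Ψ v) = (B (l v) : N →L[ℝ] N) (n v) := fun v => by
    have h1 : M.form D.v₀ (Φ B (v - X v)) = l v := (hΦl _ _).trans (hlT' _ _)
    simp only [Ψ]
    rw [hnγ, hΦn, h1, hlT', ← hBA', ← map_add, map_sub, hni, sub_add_cancel]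
  have hYΨ : ∀ v, Y (Ψ v) = X v := fun v => by
    simp only [Y, hΨl, hΨn, hCB, X]
  have hXΨ : ∀ v, X (Ψ' v) = Y v := fun v => by
    have h1 : l (D.gamma (-Y v) v) = l v := D.form_v₀_gamma _ _
    have h2 : n (Ψ' v) = (C (l v) : N →L[ℝ] N) (n v) := by
      simp only [Ψ']
      rw [map_add, hΦn, h1, hnγ, map_neg, ← hBA', ← sub_eq_add_neg, map_sub, hCB, hni,
        sub_add_cancel]
    simp only [X, h2, Y]
  refine ⟨⟨⟨Ψ, Ψ', fun v => ?_, fun v => ?_⟩, ?_, ?_⟩, fun x v => ?_⟩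
  · change Φ C (D.gamma (-Y (Ψ v)) (Ψ v)) + Y (Ψ v) = v
    rw [hYΨ, hγ2, hΦΦ, sub_add_cancel]
  · change D.gamma (X (Ψ' v)) (Φ B (Ψ' v - X (Ψ' v))) = v
    rw [hXΨ]
    simp only [Ψ']
    rw [add_sub_cancel_right, hΦΦ', hγ1]
  · exact D.continuous_gamma.comp (hXc.prodMk ((hΦc B hB).comp
      (continuous_id.sub (continuous_subtype_val.comp hXc))))
  · exact ((hΦc C hC).comp (D.continuous_gamma.comp (hYc.neg.prodMk continuous_id))).add
      (continuous_subtype_val.comp hYc)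
  · change D.gamma (X (x + v)) (Φ B (x + v - X (x + v))) = D.gamma x (D.gamma (X v) (Φ B (v - X v)))
    have h1 : X (x + v) = x + X v := by
      simp only [X, map_add, hni, hPi]
    rw [h1, gamma_add, Submodule.coe_add, add_sub_add_left_eq_sub]

theorem nonempty_homeomorph {D : M.ParabolicData} (hD : D.KerTrivial) :
    Nonempty (FlatQuotient D.group ≃ₜ (D.T ⧸ D.Λ) × (V ⧸ D.T)) := by
  obtain ⟨Ψ, hΨ⟩ := exists_equivariant_homeomorph hD
  exact nonempty_homeomorph_of_equivariant D.gamma (fun _ => D.mem_group_iff) Ψ hΨ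

end ParabolicData

end Minkowski

/-! ### Approximation by and discreteness of additive subgroups -/

/-- Simultaneous approximation: multiples of a vector of the span of an additive subgroup come
close to the subgroup. -/
theorem AddSubgroup.exists_norm_nsmul_sub_lt {E : Type*} [NormedAddCommGroup E] [NormedSpace ℝ E]
    [FiniteDimensional ℝ E] (S : AddSubgroup E) {w : E} (hw : w ∈ Submodule.span ℝ (S : Set E))
    {δ : ℝ} (hδ : 0 < δ) : ∃ m : ℕ, 1 ≤ m ∧ ∃ g ∈ S, ‖(m : ℝ) • w - g‖ < δ := by
  obtain ⟨n, f, g, rfl⟩ := Submodule.mem_span_set'.mp hw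
  -- u k differs from kw by an element of S, yet stays bounded. Two close terms of a convergent
  -- subsequence give the required multiple of w.
  let u : ℕ → E := fun k => ∑ i, Int.fract (k * f i) • (g i : E)
  have hu : ∀ k, ∃ p ∈ S, u k = (k : ℝ) • (∑ i, f i • (g i : E)) - p := by
    intro k
    refine ⟨∑ i, ⌊k * f i⌋ • (g i : E), sum_mem fun i _ => zsmul_mem (g i).2 _, ?_⟩
    rw [Finset.smul_sum, ← Finset.sum_sub_distrib]
    refine Finset.sum_congr rfl fun i _ => ?_
    rw [smul_smul, ← Int.self_sub_floor, sub_smul, Int.cast_smul_eq_zsmul]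
  have hb : ∀ k, u k ∈ Metric.closedBall (0 : E) (∑ i, ‖(g i : E)‖) := by
    intro k
    rw [mem_closedBall_zero_iff]
    refine norm_sum_le_of_le _ fun i _ => ?_
    rw [norm_smul, Real.norm_of_nonneg (Int.fract_nonneg _)]
    exact mul_le_of_le_one_left (norm_nonneg _) (Int.fract_lt_one _).le
  obtain ⟨a, -, φ, hφ, hlim⟩ := tendsto_subseq_of_bounded Metric.isBounded_closedBall hb
  obtain ⟨N, hN⟩ := Metric.cauchySeq_iff'.mp hlim.cauchySeq δ hδ
  have h1 := hN (N + 1) (Nat.le_succ N)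
  have h2 : φ N < φ (N + 1) := hφ (Nat.lt_succ_self N)
  obtain ⟨p, hp, hup⟩ := hu (φ (N + 1))
  obtain ⟨q, hq, huq⟩ := hu (φ N)
  refine ⟨φ (N + 1) - φ N, by omega, p - q, sub_mem hp hq, ?_⟩
  rw [dist_eq_norm, Function.comp_apply, Function.comp_apply, hup, huq] at h1
  rw [Nat.cast_sub h2.le, sub_smul]
  rwa [sub_sub_sub_comm]

theorem AddSubgroup.discreteTopology_of_finite {E : Type*} [NormedAddCommGroup E]
    {Λ : AddSubgroup E} (h : {x | x ∈ Λ ∧ ‖x‖ ≤ 1}.Finite) : DiscreteTopology Λ := by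
  refine discreteTopology_of_isOpen_singleton_zero ?_
  have h1 : ({x | x ∈ Λ ∧ ‖x‖ ≤ 1} \ {0}).Finite := h.subset Set.sdiff_subset
  have h2 : IsOpen (Metric.ball (0 : E) 1 \ ({x | x ∈ Λ ∧ ‖x‖ ≤ 1} \ {0})) :=
    Metric.isOpen_ball.sdiff h1.isClosed
  convert h2.preimage (continuous_subtype_val : Continuous (Subtype.val : Λ → E)) using 1
  ext ⟨x, hx⟩
  simp only [Set.mem_singleton_iff, Set.mem_preimage, Set.mem_sdiff, mem_ball_zero_iff,
    Set.mem_ofPred_eq, AddSubgroup.mk_eq_zero]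
  constructor
  · rintro rfl; simp
  · rintro ⟨h3, h4⟩
    by_contra h0
    exact h4 ⟨⟨hx, h3.le⟩, h0⟩

/-! ### Unipotent isometries and a common fixed isotropic vector -/

namespace Minkowski

section Algebra

variable {V : Type*} [AddCommGroup V] [Module ℝ V] {M : Minkowski V}

/-- The second null vector is found in the plane of e and v₀. Its form is recorded because whatever
is orthogonal to e and v₀ is then orthogonal to it. -/
theorem exists_isNullFrame {e v₀ : V} (heC : e ∈ M.cone) (he : 0 < M.form e e)
    (h₀C : v₀ ∈ M.cone) (h₀ : M.form v₀ v₀ = 0) (hne : v₀ ≠ 0) :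
    ∃ a b : ℝ, M.IsNullFrame v₀ (a • e + b • v₀) := by
  have h1 : 0 < M.form e v₀ := by
    refine lt_of_le_of_ne (M.form_nonneg heC h₀C) fun h => ?_
    linarith [M.form_self_neg_of_orthogonal he h.symm hne]
  have h2 : M.form v₀ e = M.form e v₀ := M.symm _ _
  set t := M.form e v₀ with ht
  set q := M.form e e with hq
  have hself : M.form (t⁻¹ • e + (-(q / (2 * t ^ 2))) • v₀)
      (t⁻¹ • e + (-(q / (2 * t ^ 2))) • v₀) = 0 := by
    simp only [map_add, map_smul, LinearMap.add_apply, LinearMap.smul_apply, smul_eq_mul, h₀, h2,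
      ← ht, ← hq]
    field_simp; ring
  refine ⟨t⁻¹, -(q / (2 * t ^ 2)), h₀C, ?_, h₀, hself, ?_⟩
  · rw [M.cone_eq_of_timelike heC he]
    refine ⟨hself.ge, ?_⟩
    simp only [map_add, map_smul, smul_eq_mul, ← ht, ← hq]
    have : t⁻¹ * q + -(q / (2 * t ^ 2)) * t = q / (2 * t) := by field_simp; ring
    rw [this]; positivity
  · simp only [map_add, map_smul, smul_eq_mul, h₀, h2]
    field_simp; ring

theorem form_sub_apply_of_fixed {g : V →ₗ[ℝ] V}
    (hg : ∀ v w, M.form (g v) (g w) = M.form v w) {w : V} (hw : g w = w) (v : V) :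
    M.form (g v - v) w = 0 := by
  have := hg v w
  rw [hw] at this
  rw [map_sub, LinearMap.sub_apply, this, sub_self]

/-- A nonzero value w of the last nonvanishing power of g − 1 is fixed by g and lies in the image of
g − 1. That image is orthogonal to all fixed vectors, so ℓ(w,w) = 0. -/
theorem exists_fixed_isotropic {g : V →ₗ[ℝ] V}
    (hg : ∀ v w, M.form (g v) (g w) = M.form v w) (hn : IsNilpotent (g - 1)) (hne : g ≠ 1) :
    ∃ v₀ ∈ M.cone, v₀ ≠ 0 ∧ M.form v₀ v₀ = 0 ∧ g v₀ = v₀ := by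
  obtain ⟨k, hk1, hk⟩ : ∃ k, (g - 1) ^ (k + 1) ≠ 0 ∧ (g - 1) ^ (k + 2) = 0 := by
    classical
    have hk := Nat.find_spec hn
    have hk' := fun m => Nat.find_min hn (m := m)
    rcases h : Nat.find hn with _ | _ | k
    · rw [h, pow_zero] at hk
      exact absurd (LinearMap.ext fun v => by
        have : v = 0 := LinearMap.congr_fun hk v
        simp [this]) hne
    · rw [h, zero_add, pow_one] at hk
      exact absurd (sub_eq_zero.mp hk) hne
    · exact ⟨k, hk' (k + 1) (by omega), by rwa [h] at hk⟩
  obtain ⟨v, hv⟩ : ∃ v, ((g - 1) ^ (k + 1)) v ≠ 0 := by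
    by_contra h
    push Not at h
    exact hk1 (LinearMap.ext h)
  set w := ((g - 1) ^ (k + 1)) v with hw
  have h1 : w = g (((g - 1) ^ k) v) - ((g - 1) ^ k) v := by rw [hw, pow_succ']; rfl
  have h2 : g w = w := by
    have h3 : (g - 1) w = 0 := by
      have : (g - 1) w = ((g - 1) ^ (k + 2)) v := by rw [hw, pow_succ' _ (k + 1)]; rfl
      rw [this, hk]; rfl
    exact sub_eq_zero.mp h3
  have h3 : M.form w w = 0 := by
    have := form_sub_apply_of_fixed hg h2 (((g - 1) ^ k) v)
    rwa [← h1] at this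
  rcases M.mem_cone_or_neg_mem_cone h3.ge with h4 | h4
  · exact ⟨w, h4, hv, h3, h2⟩
  · exact ⟨-w, h4, neg_ne_zero.mpr hv, by simpa using h3, by rw [map_neg, h2]⟩

theorem IsNullFrame.nproj_nu {v₀ v₁ : V} (h : M.IsNullFrame v₀ v₁) {x : V}
    (hx₀ : M.form v₀ x = 0) (hx₁ : M.form v₁ x = 0) : M.nproj v₀ v₁ (M.nu v₀ x v₁) = x := by
  simp only [nproj_apply, nu_apply, map_add, map_sub, map_smul, h.self₀, h.self₁, h.form_eq,
    h.swap.form_eq, hx₀, hx₁]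
  module

/-- A unipotent isometry that fixes `v₀` has the form `ν(x)`. -/
theorem IsNullFrame.eq_nu {v₀ v₁ : V} (h : M.IsNullFrame v₀ v₁) {g : V →ₗ[ℝ] V}
    (hg : ∀ v w, M.form (g v) (g w) = M.form v w) (hn : IsNilpotent (g - 1)) (h₀ : g v₀ = v₀) :
    g = M.nu v₀ (M.nproj v₀ v₁ (g v₁)) := by
  have horth : ∀ v, M.form v₀ (g v - v) = 0 := fun v => by
    rw [M.symm]; exact form_sub_apply_of_fixed hg h₀ v
  -- Let z = gy − y. If gz = z + cv₀, then ℓ(gy,gz) = ℓ(y,z) and ℓ(gy,v₀) = 0 give ℓ(z,z) = 0, so z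
  -- ∈ v₀^⊥ is a multiple of v₀. Nilpotence thus descends until g is trivial on v₀^⊥ modulo v₀;
  -- invariance of ℓ then determines g from gv₁.
  have hstep : ∀ y, M.form v₀ y = 0 → (∃ c : ℝ, g (g y - y) - (g y - y) = c • v₀) →
      ∃ c : ℝ, g y - y = c • v₀ := by
    rintro y hy ⟨c, hc⟩
    refine ⟨_, h.eq_smul_of_orthogonal (horth y) (le_of_eq ?_)⟩
    have h1 := hg y (g y - y)
    have h2 : g (g y - y) = (g y - y) + c • v₀ := by rw [← hc]; abel
    have h3 : M.form y v₀ = 0 := by rw [M.symm]; exact hy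
    have h4 : M.form (g y) v₀ = 0 := by rw [← h3, ← hg y v₀, h₀]
    rw [h2, map_add, map_smul, h4, smul_zero, add_zero] at h1
    rw [map_sub M.form, LinearMap.sub_apply, h1, sub_self]
  have hiter : ∀ k : ℕ, ∀ y : V, M.form v₀ y = 0 → (∃ c : ℝ, ((g - 1) ^ (k + 1)) y = c • v₀) →
      ∃ c : ℝ, g y - y = c • v₀ := by
    intro k
    induction k with
    | zero =>
      rintro y - ⟨c, hc⟩
      exact ⟨c, by rw [← hc, zero_add, pow_one]; rfl⟩
    | succ k ih =>
      rintro y hy ⟨c, hc⟩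
      refine hstep y hy (ih (g y - y) (horth y) ⟨c, ?_⟩)
      rw [← hc, pow_succ _ (k + 1)]; rfl
  have hperp : ∀ y, M.form v₀ y = 0 → ∃ c : ℝ, g y - y = c • v₀ := by
    intro y hy
    obtain ⟨k, hk⟩ := hn
    exact hiter k y hy ⟨0, by rw [pow_succ, hk]; simp⟩
  set x := M.nproj v₀ v₁ (g v₁) with hx
  have hx₀ : M.form v₀ x = 0 := h.form_nproj₀ _
  have hx₁ : M.form v₁ x = 0 := h.form_nproj₁ _
  have hg₀ : M.form v₀ (g v₁) = 1 := by
    have := horth v₁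
    rw [map_sub, h.form_eq] at this
    linarith
  have hgv₁ : g v₁ = v₁ + x + M.form v₁ (g v₁) • v₀ := by
    have := M.eq_add_nproj v₀ v₁ (g v₁)
    rw [hg₀, ← hx] at this
    rw [one_smul] at this
    nth_rewrite 1 [this]; abel
  set c := M.form v₁ (g v₁) with hc
  have hc' : M.form x x + 2 * c = 0 := by
    have := hg v₁ v₁
    rw [hgv₁, h.self₁] at this
    simp only [map_add, map_smul, LinearMap.add_apply, LinearMap.smul_apply, smul_eq_mul, h.self₀,
      h.self₁, h.form_eq, h.swap.form_eq, hx₀, hx₁, M.symm x v₀, M.symm x v₁] at this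
    linarith
  have hN : ∀ y, M.form v₀ y = 0 → M.form v₁ y = 0 → g y = y - M.form y x • v₀ := by
    intro y hy₀ hy₁
    obtain ⟨f, hf⟩ := hperp y hy₀
    have hgy : g y = y + f • v₀ := by rw [← hf]; abel
    have := hg v₁ y
    rw [hgv₁, hgy, hy₁] at this
    simp only [map_add, map_smul, LinearMap.add_apply, LinearMap.smul_apply, smul_eq_mul, h.self₀,
      h.swap.form_eq, hy₀, hy₁, M.symm x v₀, hx₀, M.symm x y] at this
    rw [hgy, show f = -M.form y x by linarith]; module
  ext v
  have hv := M.eq_add_nproj v₀ v₁ v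
  have hy₀ := h.form_nproj₀ v
  have hy₁ := h.form_nproj₁ v
  set y := M.nproj v₀ v₁ v with hy
  have hvx : M.form v x = M.form y x := by
    nth_rewrite 1 [hv]
    simp [hx₀, hx₁]
  rw [nu_apply, hvx]
  have : g v = M.form v₁ v • v₀ + M.form v₀ v • (v₁ + x + c • v₀) + (y - M.form y x • v₀) := by
    rw [← hN y hy₀ hy₁, ← hgv₁]
    nth_rewrite 1 [hv]
    rw [map_add, map_add, map_smul, map_smul, h₀]
  clear_value y
  generalize M.form v₁ v = A at hv this
  generalize M.form v₀ v = B at hv this ⊢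
  rw [this, show c = -(1 / 2) * M.form x x by linarith, hv]
  module

/-- Terms odd in x cancel, and the remainder has rank at most one, so traces of products of such
operators are explicit. -/
theorem nu_add_nu_neg_sub (v₀ x : V) : M.nu v₀ x + M.nu v₀ (-x) - 2 =
    (M.form v₀).smulRight (-M.form x x • v₀) := by
  rw [← one_add_one_eq_two]
  ext v
  change M.nu v₀ x v + M.nu v₀ (-x) v - ((1 : V →ₗ[ℝ] V) + 1) v = M.form v₀ v • (-M.form x x • v₀)
  simp only [nu_apply, map_neg, LinearMap.neg_apply, LinearMap.add_apply, Module.End.one_apply]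
  module

theorem nu_zero (v₀ : V) : M.nu v₀ 0 = 1 := by
  ext v; simp [nu_apply]

end Algebra

section Unipotent

variable {V : Type*} [NormedAddCommGroup V] [NormedSpace ℝ V] [FiniteDimensional ℝ V]
  {M : Minkowski V} {Γ : Subgroup (V ≃ᵃ[ℝ] V)}

/-- Removing from a timelike vector its component in the negative definite T only increases the
square. -/
theorem exists_timelike_orthogonal (T : Submodule ℝ V) (hT : ∀ x ∈ T, x ≠ 0 → M.form x x < 0) :
    IsCompl T (M.form.orthogonal T) ∧
      ∃ e ∈ M.cone, 0 < M.form e e ∧ ∀ x ∈ T, M.form x e = 0 := by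
  have hrefl : M.form.IsRefl := fun v w h => by rw [M.symm]; exact h
  have hdisj : Disjoint T (M.form.orthogonal T) := by
    rw [Submodule.disjoint_def]
    intro x hx hx'
    by_contra h0
    have h1 : M.form x x = 0 := hx' x hx
    linarith [hT x hx h0]
  have hcompl := (LinearMap.BilinForm.isCompl_orthogonal_iff_disjoint hrefl).mpr hdisj
  refine ⟨hcompl, ?_⟩
  obtain ⟨f, hfC, hf⟩ := M.exists_timelike
  obtain ⟨t, ht, e, he, rfl⟩ := Submodule.mem_sup.mp
    (hcompl.sup_eq_top ▸ Submodule.mem_top : f ∈ T ⊔ M.form.orthogonal T)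
  have he' : ∀ x ∈ T, M.form x e = 0 := fun x hx => he x hx
  have htt : M.form t t ≤ 0 := by
    by_cases h0 : t = 0
    · simp [h0]
    · exact (hT t ht h0).le
  rw [form_add_self, he' t ht] at hf
  have hee : 0 < M.form e e := by linarith
  rcases M.mem_cone_or_neg_mem_cone hee.le with h1 | h1
  · exact ⟨e, h1, hee, he'⟩
  · exact ⟨-e, h1, by simpa using hee, fun x hx => by rw [map_neg, he' x hx, neg_zero]⟩

omit [FiniteDimensional ℝ V] in
-- f maps Λ into the orbit of 0, and properness leaves finitely many orbit points in the compact
-- image of the unit ball.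
theorem IsFlatGroup.discreteTopology_of_injective {E : Type*} [NormedAddCommGroup E] [NormedSpace ℝ E]
    [FiniteDimensional ℝ E] (hΓ : M.IsFlatGroup Γ) {Λ : AddSubgroup E} {f : E → V}
    (hf : Continuous f) (hinj : Function.Injective f) (hΛ : ∀ x ∈ Λ, ∃ γ ∈ Γ, γ 0 = f x) :
    DiscreteTopology Λ := by
  refine AddSubgroup.discreteTopology_of_finite ?_
  have h1 := hΓ.proper.finite_disjoint_inter_image (K := {0}) (L := f '' Metric.closedBall 0 1)
    isCompact_singleton ((isCompact_closedBall _ _).image hf)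
  refine Set.Finite.of_finite_image (f := f) ((h1.image fun g : Γ => g • (0 : V)).subset ?_)
    hinj.injOn
  rintro _ ⟨x, ⟨hx, hx1⟩, rfl⟩
  obtain ⟨γ, hγ, h2⟩ := hΛ x hx
  exact ⟨⟨γ, hγ⟩, ⟨f x, ⟨0, rfl, h2⟩, ⟨x, by simpa using hx1, rfl⟩⟩, h2⟩

/-- Suppose γ fixes v₀ and δ does not. Then δ fixes another isotropic w₀, and g + g⁻¹ − 2 is a
nonzero multiple of ℓ(v₀,·)v₀ for γ and of ℓ(w₀,·)w₀ for δ. The trace of the product is a nonzero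
multiple of ℓ(v₀,w₀)²; unipotency makes it zero, so v₀ is proportional to w₀ and is fixed by δ after
all. -/
theorem IsFlatGroup.linear_one_or_exists_fixed (hΓ : M.IsFlatGroup Γ) (hu : IsUnipotent Γ) :
    (∀ γ ∈ Γ, (γ.linear : V →ₗ[ℝ] V) = 1) ∨
      ∃ v₀ ∈ M.cone, v₀ ≠ 0 ∧ M.form v₀ v₀ = 0 ∧ ∀ γ ∈ Γ, γ.linear v₀ = v₀ := by
  by_contra! hcon
  obtain ⟨⟨γ, hγ, hγ1⟩, hfix⟩ := hcon
  obtain ⟨v₀, h₀C, h₀ne, h₀, hγ₀⟩ :=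
    exists_fixed_isotropic (g := γ.linear.toLinearMap) (hΓ.form_eq γ hγ) (hu γ hγ) hγ1
  obtain ⟨δ, hδ, hδ₀⟩ := hfix v₀ h₀C h₀ne h₀
  have hδ1 : (δ.linear : V →ₗ[ℝ] V) ≠ 1 := fun h => hδ₀ (LinearMap.congr_fun h v₀)
  obtain ⟨w₀, hw₀C, hw₀ne, hw₀, hδw⟩ :=
    exists_fixed_isotropic (g := δ.linear.toLinearMap) (hΓ.form_eq δ hδ) (hu δ hδ) hδ1
  obtain ⟨e, heC, he⟩ := M.exists_timelike
  have key : ∀ {u₀ : V}, u₀ ∈ M.cone → u₀ ≠ 0 → M.form u₀ u₀ = 0 → ∀ g ∈ Γ,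
      (g.linear : V →ₗ[ℝ] V) ≠ 1 → g.linear u₀ = u₀ → ∃ q : ℝ, q ≠ 0 ∧
        ((g.linear : V →ₗ[ℝ] V) + ((g⁻¹ : V ≃ᵃ[ℝ] V).linear : V →ₗ[ℝ] V) - 2) =
          (M.form u₀).smulRight (q • u₀) := by
    intro u₀ hC hne h₀ g hg hg1 hfix
    obtain ⟨a, b, hf⟩ := exists_isNullFrame heC he hC h₀ hne
    set v₁ := a • e + b • u₀
    have h1 := hf.eq_nu (g := g.linear.toLinearMap) (hΓ.form_eq g hg) (hu g hg) hfix
    set x := M.nproj u₀ v₁ ((g.linear : V →ₗ[ℝ] V) v₁) with hx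
    have hx₀ : M.form u₀ x = 0 := hf.form_nproj₀ _
    have hx₁ : M.form v₁ x = 0 := hf.form_nproj₁ _
    have hx0 : x ≠ 0 := fun h => hg1 (by rw [h1, h, nu_zero])
    have h2 : ((g⁻¹ : V ≃ᵃ[ℝ] V).linear : V →ₗ[ℝ] V) = M.nu u₀ (-x) := by
      ext v
      have h3 : (g.linear : V →ₗ[ℝ] V) (M.nu u₀ (-x) v) = v := by
        rw [h1, ← nu_add h₀ hx₀ (by simpa using hx₀), add_neg_cancel, nu_zero]; rfl
      exact (g.linear.symm_apply_eq).mpr h3.symm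
    refine ⟨-M.form x x, neg_ne_zero.mpr (hf.form_self_neg hx₀ hx₁ hx0).ne, ?_⟩
    rw [h2, h1, nu_add_nu_neg_sub]
  obtain ⟨q, hq, hqγ⟩ := key h₀C h₀ne h₀ γ hγ hγ1 hγ₀
  obtain ⟨r, hr, hrδ⟩ := key hw₀C hw₀ne hw₀ δ hδ hδ1 hδw
  have htr : ∀ g ∈ Γ, LinearMap.trace ℝ V (g.linear : V →ₗ[ℝ] V) = LinearMap.trace ℝ V 1 := by
    intro g hg
    have := (LinearMap.isNilpotent_trace_of_isNilpotent (hu g hg)).eq_zero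
    rw [map_sub] at this
    exact sub_eq_zero.mp this
  have hmul : ∀ g k : V ≃ᵃ[ℝ] V, (g.linear : V →ₗ[ℝ] V) * (k.linear : V →ₗ[ℝ] V) =
      ((g * k).linear : V →ₗ[ℝ] V) := fun _ _ => rfl
  -- All group elements have linear parts of the same trace, so the expanded product contributes the
  -- coefficient sum (1 + 1 − 2)² = 0.
  have hprod : LinearMap.trace ℝ V
      (((γ.linear : V →ₗ[ℝ] V) + ((γ⁻¹ : V ≃ᵃ[ℝ] V).linear : V →ₗ[ℝ] V) - 2) *
        ((δ.linear : V →ₗ[ℝ] V) + ((δ⁻¹ : V ≃ᵃ[ℝ] V).linear : V →ₗ[ℝ] V) - 2)) = 0 := by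
    have h2 : (2 : Module.End ℝ V) = 1 + 1 := one_add_one_eq_two.symm
    rw [h2]
    simp only [add_mul, mul_add, sub_mul, mul_sub, mul_one, one_mul, hmul, map_add, map_sub,
      htr _ hγ, htr _ hδ, htr _ (inv_mem hγ), htr _ (inv_mem hδ), htr _ (mul_mem hγ hδ),
      htr _ (mul_mem (inv_mem hγ) hδ), htr _ (mul_mem hγ (inv_mem hδ)),
      htr _ (mul_mem (inv_mem hγ) (inv_mem hδ))]
    ring
  rw [hqγ, hrδ] at hprod
  have hcomp : (M.form v₀).smulRight (q • v₀) * (M.form w₀).smulRight (r • w₀) =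
      (M.form w₀).smulRight ((r * M.form v₀ w₀ * q) • v₀) := by
    ext v
    change M.form v₀ (M.form w₀ v • r • w₀) • q • v₀ = M.form w₀ v • (r * M.form v₀ w₀ * q) • v₀
    simp only [map_smul, smul_smul, smul_eq_mul]
    ring_nf
  rw [hcomp, LinearMap.trace_smulRight, map_smul, M.symm w₀ v₀, smul_eq_mul] at hprod
  have h3 : M.form v₀ w₀ = 0 := by
    have : r * q * M.form v₀ w₀ ^ 2 = 0 := by linear_combination hprod
    simpa [hr, hq] using this
  obtain ⟨a, b, hf⟩ := exists_isNullFrame heC he hw₀C hw₀ hw₀ne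
  have h4 := hf.eq_smul_of_orthogonal (by rw [M.symm]; exact h3) h₀.ge
  rw [h4, map_smul, show δ.linear w₀ = w₀ from hδw] at hδ₀
  exact hδ₀ rfl

end Unipotent

end Minkowski

/-! ### Additive parameters (α,b) and the effect of strict causality on their span -/

namespace Minkowski

/-- By `hb` and `hk` the map with parameters −m(α,b) moves v exactly by −mv₀, the quadratic terms
cancelling. The symmetry `hs` makes composition with (α',b') additive in the parameters, and v₀ is
fixed by the linear part. -/
theorem parabolicMap_sub_smul {V : Type*} [AddCommGroup V] [Module ℝ V] {M : Minkowski V}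
    {v₀ : V} {α b α' b' v : V} {k : ℝ} (hα : M.form v₀ α = 0)
    (hα' : M.form v₀ α' = 0) (hs : M.form α b' = M.form b α')
    (hb : b + M.form v₀ v • α = k • v₀) (hk : k - M.form v α = 1) (m : ℝ) :
    M.parabolicMap v₀ (α' - m • α) (b' - m • b) v = M.parabolicMap v₀ α' b' v - m • v₀ := by
  have h1 := parabolicMap_sub_self (M := M) v₀ (α' - m • α) (b' - m • b) v
  have h2 := parabolicMap_sub_self (M := M) v₀ α' b' v
  rw [sub_eq_iff_eq_add] at h1 h2
  obtain rfl : b = k • v₀ - M.form v₀ v • α := eq_sub_of_add_eq hb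
  obtain rfl : k = 1 + M.form v α := by linarith
  rw [h1, h2]
  generalize M.form v₀ v = s at hs ⊢
  have hs' : M.form α b' = -(s * M.form α α') := by
    rw [hs, map_sub, map_smul, map_smul]
    simp [hα']
  simp only [map_sub, map_smul, LinearMap.sub_apply, LinearMap.smul_apply, smul_eq_mul, hs',
    M.symm α' α, M.symm α v₀, M.symm α' v₀, hα, hα']
  module

variable {V : Type*} [NormedAddCommGroup V] [NormedSpace ℝ V] [FiniteDimensional ℝ V]
  {M : Minkowski V} {Γ : Subgroup (V ≃ᵃ[ℝ] V)}

theorem continuous_parabolicMap (v₀ v : V) :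
    Continuous fun w : V × V => M.parabolicMap v₀ w.1 w.2 v := by
  simp only [parabolicMap, nu_apply]
  have h1 : Continuous fun w : V × V => w.1 := continuous_fst
  have h2 : Continuous fun w : V × V => w.2 := continuous_snd
  exact ((continuous_const.add (h1.const_smul _)).sub
    ((((continuous_const (y := v)).minkowski_form h1).add
    (continuous_const.mul (h1.minkowski_form h1))).smul continuous_const)).add
    (h2.sub ((continuous_const.mul (h1.minkowski_form h2)).smul continuous_const))

/-- A subgroup of `V × V` whose elements `(α,b)` parametrize transformations of a group by
the mappings `parabolicMap v₀ α b`. -/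
structure IsParabolicParam (M : Minkowski V) (Γ : Subgroup (V ≃ᵃ[ℝ] V)) (v₀ v₁ : V)
    (S : AddSubgroup (V × V)) : Prop where
  frame : M.IsNullFrame v₀ v₁
  exists_mem : ∀ p ∈ S, ∃ γ ∈ Γ, ∀ v, γ v = M.parabolicMap v₀ p.1 p.2 v
  exists_param : ∀ γ ∈ Γ, ∃ p ∈ S, ∀ v, γ v = M.parabolicMap v₀ p.1 p.2 v
  fst_orth₀ : ∀ p ∈ S, M.form v₀ p.1 = 0
  fst_orth₁ : ∀ p ∈ S, M.form v₁ p.1 = 0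
  snd_orth : ∀ p ∈ S, M.form v₀ p.2 = 0
  symm : ∀ p ∈ S, ∀ q ∈ S, M.form p.1 q.2 = M.form p.2 q.1

namespace IsParabolicParam

variable {v₀ v₁ : V} {S : AddSubgroup (V × V)} (hS : M.IsParabolicParam Γ v₀ v₁ S)
include hS

omit [FiniteDimensional ℝ V] in
theorem span_orth {w : V × V} (hw : w ∈ Submodule.span ℝ (S : Set (V × V))) :
    M.form v₀ w.1 = 0 ∧ M.form v₁ w.1 = 0 ∧ M.form v₀ w.2 = 0 := by
  induction hw using Submodule.span_induction with
  | mem p hp => exact ⟨hS.fst_orth₀ p hp, hS.fst_orth₁ p hp, hS.snd_orth p hp⟩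
  | zero => simp
  | add x y _ _ hx hy => simp [hx, hy]
  | smul t x _ hx => simp [hx]

omit [FiniteDimensional ℝ V] in
theorem span_symm {w w' : V × V} (hw : w ∈ Submodule.span ℝ (S : Set (V × V)))
    (hw' : w' ∈ Submodule.span ℝ (S : Set (V × V))) : M.form w.1 w'.2 = M.form w.2 w'.1 := by
  induction hw using Submodule.span_induction with
  | mem p hp =>
    induction hw' using Submodule.span_induction with
    | mem q hq => exact hS.symm p hp q hq
    | zero => simp
    | add x y _ _ hx hy => simp [hx, hy]
    | smul t x _ hx => simp [hx]
  | zero => simp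
  | add x y _ _ hx hy => simp [hx, hy]
  | smul t x _ hx => simp [hx]

/-- Here w would move v along v₀ at unit speed. If p ∈ S is close to mw with m ≥ 1, the element of Γ
with parameters −p moves v nearly to v − mv₀, so points near v − εv₀ with 0 < ε < 1 lie in the
future of that image. The past ray would accumulate on the future. -/
theorem not_smul_isotropic (hΓ : M.IsFlatGroup Γ) (hc : M.IsStrictlyCausal Γ) {w : V × V}
    (hw : w ∈ Submodule.span ℝ (S : Set (V × V))) {v : V} {k : ℝ}
    (hb : w.2 + M.form v₀ v • w.1 = k • v₀) (hk : k - M.form v w.1 = 1) : False := by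
  refine hS.frame.ne_zero (hΓ.eq_zero_of_mem_closure_future hc (v := v) hS.frame.mem₀
    fun ε hε hε1 => ?_)
  rw [mem_closure_iff]
  intro O hO hvO
  have hcont : Continuous fun w : V × V => M.parabolicMap v₀ w.1 w.2 v - ε • v₀ :=
    (continuous_parabolicMap v₀ v).sub continuous_const
  have h1 : ∀ᶠ w' in 𝓝 (0 : V × V), M.parabolicMap v₀ w'.1 w'.2 v - ε • v₀ ∈ O := by
    refine hcont.continuousAt.eventually_mem (hO.mem_nhds ?_)
    simpa [parabolicMap, nu_apply] using hvO
  obtain ⟨δ, hδ, h2⟩ := Metric.eventually_nhds_iff.mp h1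
  obtain ⟨m, hm, p, hp, hmp⟩ := S.exists_norm_nsmul_sub_lt hw hδ
  obtain ⟨w', hw'⟩ : ∃ w', w' = (m : ℝ) • w - p := ⟨_, rfl⟩
  rw [← hw'] at hmp
  have hw'S : w' ∈ Submodule.span ℝ (S : Set (V × V)) :=
    hw' ▸ Submodule.sub_mem _ (Submodule.smul_mem _ _ hw) (Submodule.subset_span hp)
  refine ⟨_, h2 (y := w') (by rwa [dist_zero_right]), ?_⟩
  rw [Set.mem_preimage, hΓ.proj_mem_future_iff]
  obtain ⟨γ, hγ, hγv⟩ := hS.exists_mem (-p) (neg_mem hp)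
  refine ⟨γ, hγ, ?_⟩
  have h3 : -p = w' - (m : ℝ) • w := by rw [hw']; abel
  obtain ⟨o1, -, -⟩ := hS.span_orth hw
  obtain ⟨o3, -, -⟩ := hS.span_orth hw'S
  rw [hγv, h3, Prod.fst_sub, Prod.snd_sub, Prod.smul_fst, Prod.smul_snd,
    parabolicMap_sub_smul o1 o3 (hS.span_symm hw hw'S) hb hk]
  have h4 : M.parabolicMap v₀ w'.1 w'.2 v - ε • v₀ - (M.parabolicMap v₀ w'.1 w'.2 v - (m : ℝ) • v₀)
      = ((m : ℝ) - ε) • v₀ := by module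
  rw [h4]
  have h5 : (1 : ℝ) ≤ m := by exact_mod_cast hm
  exact M.smul_mem_cone hS.frame.mem₀ (by linarith)

/-- A nonzero w with b + sα ∈ ℝv₀ would, at a suitable v with ℓ(v₀,v) = s, give a nonzero
displacement along v₀, which rescales to the excluded situation. -/
theorem eq_zero_of_nproj_eq_zero (hΓ : M.IsFlatGroup Γ) (hc : M.IsStrictlyCausal Γ) {w : V × V}
    (hw : w ∈ Submodule.span ℝ (S : Set (V × V))) {s : ℝ}
    (h : M.nproj v₀ v₁ (w.2 + s • w.1) = 0) : w = 0 := by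
  obtain ⟨o1, o2, o3⟩ := hS.span_orth hw
  have hf := hS.frame
  set k := M.form v₁ (w.2 + s • w.1) with hk
  have hb : w.2 + s • w.1 = k • v₀ := by
    have h1 := M.eq_add_nproj v₀ v₁ (w.2 + s • w.1)
    have h2 : M.form v₀ (w.2 + s • w.1) = 0 := by simp [o1, o3]
    rw [h, h2, ← hk, zero_smul, add_zero, add_zero] at h1
    exact h1
  by_contra hw0
  -- If α = 0, the speed k is nonzero since w ≠ 0. If α ≠ 0, adding a multiple of α to sv₁ keeps
  -- ℓ(v₀,v) = s and adjusts ℓ(v,α) to k − 1.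
  obtain ⟨v, hv, hd⟩ : ∃ v, M.form v₀ v = s ∧ k - M.form v w.1 ≠ 0 := by
    by_cases h1 : w.1 = 0
    · refine ⟨s • v₁, by simp [hf.form_eq], ?_⟩
      rw [h1, map_zero, sub_zero]
      intro h2
      rw [h1, h2, smul_zero, add_zero, zero_smul] at hb
      exact hw0 (Prod.ext h1 hb)
    · have h2 := hf.form_self_neg o1 o2 h1
      refine ⟨s • v₁ + ((k - 1) / M.form w.1 w.1) • w.1, by simp [hf.form_eq, o1], ?_⟩
      have h3 : M.form (s • v₁ + ((k - 1) / M.form w.1 w.1) • w.1) w.1 = k - 1 := by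
        simp only [map_add, map_smul, LinearMap.add_apply, LinearMap.smul_apply, o2, smul_eq_mul]
        rw [mul_zero, zero_add, div_mul_cancel₀ _ h2.ne]
      rw [h3]; norm_num
  set d := k - M.form v w.1 with hd'
  refine hS.not_smul_isotropic hΓ hc (Submodule.smul_mem _ d⁻¹ hw) (v := v) (k := d⁻¹ * k) ?_ ?_
  · rw [hv, Prod.smul_snd, Prod.smul_fst, smul_comm s, ← smul_add, hb, smul_smul]
  · rw [Prod.smul_fst, map_smul, smul_eq_mul, ← mul_sub, ← hd', inv_mul_cancel₀ hd]

end IsParabolicParam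

/-- Only discreteness of Λ is not given: it follows from the orbit of 0, since x is the N-component
of γ_x(0). -/
theorem exists_parabolicData (hΓ : M.IsFlatGroup Γ) {v₀ v₁ : V} (h : M.IsNullFrame v₀ v₁)
    {T : Submodule ℝ V} (hT : T ≤ M.transverse v₀ v₁) (a : T →ₗ[ℝ] M.transverse v₀ v₁)
    (ha : ∀ x y : T, M.form (a x : V) (y : V) = M.form (x : V) (a y : V)) (Λ : AddSubgroup T)
    (hspan : Submodule.span ℝ (Λ : Set T) = ⊤)
    (hΛΓ : ∀ x ∈ Λ, ∃ γ ∈ Γ, ∀ v, γ v = M.parabolicMap v₀ (a x) x v)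
    (hΓΛ : ∀ γ ∈ Γ, ∃ x ∈ Λ, ∀ v, γ v = M.parabolicMap v₀ (a x) x v)
    (hker : ∀ t : ℝ, LinearMap.ker (Submodule.inclusion hT + t • a) = ⊥) :
    ∃ D : M.ParabolicData, D.group = Γ ∧ D.KerTrivial := by
  have hac : Continuous fun x : T => (a x : V) :=
    continuous_subtype_val.comp (LinearMap.continuous_of_finiteDimensional a)
  have h0 : ∀ x : T, M.parabolicMap v₀ (a x) x 0 = x - (1 / 2 * M.form (a x : V) x) • v₀ :=
    fun x => by simp [parabolicMap]
  have hcont : Continuous fun x : T => M.parabolicMap v₀ (a x) x 0 := by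
    simp only [h0]
    exact continuous_subtype_val.sub
      ((continuous_const.mul (hac.minkowski_form continuous_subtype_val)).smul continuous_const)
  have hinj : Function.Injective fun x : T => M.parabolicMap v₀ (a x) x 0 := by
    intro x y hxy
    simp only [h0] at hxy
    have h1 : ∀ (x : T) (c : ℝ), M.nproj v₀ v₁ (x - c • v₀) = x := fun x c => by
      rw [nproj_apply, map_sub, map_sub, map_smul, map_smul, (hT x.2).1, (hT x.2).2, h.self₀,
        h.swap.form_eq, smul_eq_mul, smul_eq_mul]
      module
    have h2 := congrArg (M.nproj v₀ v₁) hxy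
    rw [h1, h1] at h2
    exact Subtype.ext h2
  have hΛ : IsUniformLattice Λ := ⟨hΓ.discreteTopology_of_injective hcont hinj fun x hx =>
    (hΛΓ x hx).imp fun γ hγ => ⟨hγ.1, hγ.2 0⟩, hspan⟩
  let D : M.ParabolicData := ⟨v₀, v₁, h.mem_frontier₀, h.swap.mem_frontier₀, h.form_eq, T, hT,
    Λ, hΛ, a, ha⟩
  refine ⟨D, ?_, hker⟩
  ext γ
  rw [D.mem_group_iff]
  constructor
  · rintro ⟨x, hx, rfl⟩
    obtain ⟨γ, hγ, h1⟩ := hΛΓ x hx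
    have : D.gamma x = γ := by ext v; exact (h1 v).symm
    rwa [this]
  · intro hγ
    obtain ⟨x, hx, h1⟩ := hΓΛ γ hγ
    exact ⟨x, hx, by ext v; exact (h1 v).symm⟩

end Minkowski

/-! ### Classification of unipotent strictly causal groups -/

namespace Minkowski

variable {V : Type*} [NormedAddCommGroup V] [NormedSpace ℝ V] [FiniteDimensional ℝ V]
  {M : Minkowski V} {Γ : Subgroup (V ≃ᵃ[ℝ] V)}

theorem IsParabolicParam.exists_data {v₀ v₁ : V} {S : AddSubgroup (V × V)}
    (hS : M.IsParabolicParam Γ v₀ v₁ S) (hΓ : M.IsFlatGroup Γ) (hc : M.IsStrictlyCausal Γ) :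
    ∃ D : M.ParabolicData, D.group = Γ ∧ D.KerTrivial := by
  have hf := hS.frame
  let W : Submodule ℝ (V × V) := Submodule.span ℝ (S : Set (V × V))
  have hW : ∀ w : W, M.nproj v₀ v₁ (w : V × V).2 = 0 → w = 0 := fun w h =>
    Subtype.ext (hS.eq_zero_of_nproj_eq_zero hΓ hc (s := 0) w.2 (by rwa [zero_smul, add_zero]))
  let b : W →ₗ[ℝ] V := LinearMap.snd ℝ V V ∘ₗ W.subtype
  have hb : Function.Injective b := by
    rw [injective_iff_map_eq_zero]
    intro w hw
    exact hW w (by rw [show (w : V × V).2 = 0 from hw, map_zero])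
  let T : Submodule ℝ V := LinearMap.range b
  have hT : ∀ x ∈ T, x ≠ 0 → M.form x x < 0 := by
    rintro _ ⟨w, rfl⟩ hw
    have h0 : M.form v₀ (b w) = 0 := (hS.span_orth w.2).2.2
    have h1 := hf.form_self (b w)
    rw [h0, mul_zero, zero_mul, zero_add] at h1
    rw [h1]
    refine hf.form_self_neg (hf.form_nproj₀ _) (hf.form_nproj₁ _) fun h => hw ?_
    rw [hW w h, map_zero]
  -- T lies in v₀^⊥ but need not be orthogonal to v₁. As T is negative definite, a timelike e
  -- orthogonal to T exists, and the plane of e and v₀ contains a second null vector u orthogonal to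
  -- T.
  obtain ⟨-, e, heC, he, heT⟩ := M.exists_timelike_orthogonal T hT
  obtain ⟨c, d, hf'⟩ := exists_isNullFrame heC he hf.mem₀ hf.self₀ hf.ne_zero
  set u := c • e + d • v₀ with hu
  have hT₀ : ∀ x ∈ T, M.form v₀ x = 0 := by
    rintro _ ⟨w, rfl⟩
    exact (hS.span_orth w.2).2.2
  have hT₁ : ∀ x ∈ T, M.form u x = 0 := fun x hx => by
    rw [hu, M.symm, map_add, map_smul, map_smul, heT x hx, M.symm, hT₀ x hx]; simp
  clear_value u
  have hTN : T ≤ M.transverse v₀ u := fun x hx => ⟨hT₀ x hx, hT₁ x hx⟩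
  let E : W ≃ₗ[ℝ] T := LinearEquiv.ofInjective b hb
  have hE : ∀ w : W, (E w : V) = (w : V × V).2 := fun _ => rfl
  -- Projecting α along the new frame changes it only by a multiple of v₀, which does not alter the
  -- transformations.
  let f : W →ₗ[ℝ] M.transverse v₀ u := (M.nproj v₀ u ∘ₗ LinearMap.fst ℝ V V ∘ₗ W.subtype).codRestrict
    _ fun w => ⟨hf'.form_nproj₀ _, hf'.form_nproj₁ _⟩
  have hfw : ∀ w : W, (f w : V) = (w : V × V).1 + (-M.form u (w : V × V).1) • v₀ := fun w => by
    change M.nproj v₀ u (w : V × V).1 = _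
    rw [nproj_apply, (hS.span_orth w.2).1]
    module
  let a : T →ₗ[ℝ] M.transverse v₀ u := f ∘ₗ E.symm.toLinearMap
  have haE : ∀ w : W, a (E w) = f w := fun w => by simp [a]
  have hmap : ∀ (w : W) v, M.parabolicMap v₀ (a (E w)) (E w) v =
      M.parabolicMap v₀ (w : V × V).1 (w : V × V).2 v := fun w v => by
    obtain ⟨o1, -, o2⟩ := hS.span_orth w.2
    rw [haE, hfw, hE, parabolicMap_add_smul hf.self₀ o1 o2]
  let Λ : AddSubgroup T := (S.comap W.subtype.toAddMonoidHom).map E.toLinearMap.toAddMonoidHom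
  refine exists_parabolicData hΓ hf' hTN a ?_ Λ ?_ ?_ ?_ ?_
  · intro x y
    obtain ⟨w, rfl⟩ := E.surjective x
    obtain ⟨z, rfl⟩ := E.surjective y
    have h1 : M.form (w : V × V).2 v₀ = 0 := by
      rw [M.symm]; exact (hS.span_orth w.2).2.2
    have h2 := (hS.span_orth z.2).2.2
    rw [haE, haE, hfw, hfw, hE, hE, map_add, map_add, map_smul, map_smul, LinearMap.add_apply,
      LinearMap.smul_apply, h1, h2, hS.span_symm w.2 z.2]
    simp
  · have h1 : (Λ : Set T) = E '' (Subtype.val ⁻¹' (S : Set (V × V))) := rfl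
    rw [h1, ← LinearEquiv.coe_coe, ← Submodule.map_span, Submodule.span_span_coe_preimage,
      Submodule.map_top, LinearEquiv.range]
  · rintro _ ⟨w, hw, rfl⟩
    obtain ⟨γ, hγ, h1⟩ := hS.exists_mem w hw
    exact ⟨γ, hγ, fun v => (h1 v).trans (hmap w v).symm⟩
  · intro γ hγ
    obtain ⟨p, hp, h1⟩ := hS.exists_param γ hγ
    let w : W := ⟨p, Submodule.subset_span hp⟩
    exact ⟨E w, ⟨w, hp, rfl⟩, fun v => (h1 v).trans (hmap w v).symm⟩
  · intro t
    rw [LinearMap.ker_eq_bot']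
    intro x hx
    obtain ⟨w, rfl⟩ := E.surjective x
    have h1 : (w : V × V).2 + t • ((w : V × V).1 + (-M.form u (w : V × V).1) • v₀) = 0 := by
      rw [← hfw, ← haE, ← hE]
      exact congrArg Subtype.val hx
    have h2 : (w : V × V).2 + t • (w : V × V).1 = (t * M.form u (w : V × V).1) • v₀ := by
      rw [← sub_eq_zero, ← h1]; module
    have h3 : w = 0 := Subtype.ext (hS.eq_zero_of_nproj_eq_zero hΓ hc (s := t) w.2 (by
      rw [h2, map_smul, nproj_apply, hf.self₀, hf.swap.form_eq]
      simp))
    rw [h3, map_zero]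

theorem mem_interior_cone {e : V} (heC : e ∈ M.cone) (he : 0 < M.form e e) :
    e ∈ interior M.cone := by
  refine mem_interior.mpr ⟨{v | 0 < M.form v v} ∩ {v | 0 < M.form e v}, ?_,
    (isOpen_lt continuous_const (continuous_id.minkowski_form continuous_id)).inter
    (isOpen_lt continuous_const (continuous_const.minkowski_form continuous_id)), he, he⟩
  rw [M.cone_eq_of_timelike heC he]
  exact fun v hv => ⟨hv.1.le, hv.2.le⟩

omit [FiniteDimensional ℝ V] in
theorem apply_eq_of_linear {γ : V ≃ᵃ[ℝ] V} {g : V →ₗ[ℝ] V}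
    (h : (γ.linear : V →ₗ[ℝ] V) = g) (v : V) : γ v = g v + γ 0 := by
  have h1 := affineEquiv_add γ 0 v
  rw [zero_add] at h1
  rw [h1, ← h, add_comm]; rfl

/-- The set of values at the origin of the elements of a group of translations. -/
def translationSubgroup (Γ : Subgroup (V ≃ᵃ[ℝ] V))
    (h : ∀ γ ∈ Γ, (γ.linear : V →ₗ[ℝ] V) = 1) : AddSubgroup V where
  carrier := {x | ∃ γ ∈ Γ, γ 0 = x}
  zero_mem' := ⟨1, one_mem _, rfl⟩
  add_mem' := by
    rintro _ _ ⟨γ, hγ, rfl⟩ ⟨δ, hδ, rfl⟩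
    refine ⟨γ * δ, mul_mem hγ hδ, ?_⟩
    change γ (δ 0) = _
    rw [apply_eq_of_linear (h γ hγ) (δ 0), add_comm]; rfl
  neg_mem' := by
    rintro _ ⟨γ, hγ, rfl⟩
    refine ⟨γ⁻¹, inv_mem hγ, ?_⟩
    have h1 : (γ⁻¹ : V ≃ᵃ[ℝ] V) (γ 0) = 0 := γ.symm_apply_apply 0
    rw [apply_eq_of_linear (h _ (inv_mem hγ)) (γ 0)] at h1
    exact eq_neg_of_add_eq_zero_right h1

theorem IsFlatGroup.exists_data_of_linear_eq_one (hΓ : M.IsFlatGroup Γ)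
    (hc : M.IsStrictlyCausal Γ) (h : ∀ γ ∈ Γ, (γ.linear : V →ₗ[ℝ] V) = 1) :
    (∃ D : M.EllipticData, D.group = Γ) ∨ ∃ D : M.ParabolicData, D.group = Γ ∧ D.KerTrivial := by
  let S := translationSubgroup Γ h
  have hS : ∀ γ ∈ Γ, ∃ x ∈ S, ∀ v, γ v = x + v := fun γ hγ =>
    ⟨γ 0, ⟨γ, hγ, rfl⟩, fun v => by rw [apply_eq_of_linear (h γ hγ) v, add_comm]; rfl⟩
  have hS' : ∀ x ∈ S, ∃ γ ∈ Γ, ∀ v, γ v = x + v := by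
    rintro _ ⟨γ, hγ, rfl⟩
    exact ⟨γ, hγ, fun v => by rw [apply_eq_of_linear (h γ hγ) v, add_comm]; rfl⟩
  let T : Submodule ℝ V := Submodule.span ℝ (S : Set V)
  -- If x ∈ S is close to mc, then (m − ε)c − x lies in −x + C and is close to −εc, so the past ray
  -- of 0 along c lies in the closure of its future.
  have hsp : ∀ c ∈ T, c ∈ M.cone → c = 0 := by
    intro c hcT hcC
    refine hΓ.eq_zero_of_mem_closure_future hc (v := 0) hcC fun ε hε hε1 => ?_
    rw [Metric.mem_closure_iff]
    intro δ hδ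
    obtain ⟨m, hm, x, hx, hmx⟩ := S.exists_norm_nsmul_sub_lt hcT hδ
    obtain ⟨γ, hγ, hγv⟩ := hS' (-x) (neg_mem hx)
    refine ⟨((m : ℝ) - ε) • c - x, ?_, ?_⟩
    · rw [Set.mem_preimage, hΓ.proj_mem_future_iff]
      refine ⟨γ, hγ, ?_⟩
      rw [hγv, add_zero, sub_neg_eq_add, sub_add_cancel]
      have h5 : (1 : ℝ) ≤ m := by exact_mod_cast hm
      exact M.smul_mem_cone hcC (by linarith)
    · rw [dist_comm, dist_eq_norm]
      have h6 : ((m : ℝ) - ε) • c - x - (0 - ε • c) = (m : ℝ) • c - x := by module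
      rwa [h6]
  have hT : ∀ x ∈ T, x ≠ 0 → M.form x x < 0 := by
    intro x hx hx0
    by_contra hq
    rcases M.mem_cone_or_neg_mem_cone (not_lt.mp hq) with h1 | h1
    · exact hx0 (hsp x hx h1)
    · exact hx0 (neg_eq_zero.mp (hsp _ (T.neg_mem hx) h1))
  obtain ⟨hcompl, e, heC, he, heT⟩ := M.exists_timelike_orthogonal T hT
  let L := M.form.orthogonal T
  have hL : ∀ x ∈ T, ∀ y ∈ L, M.form x y = 0 := fun x hx y hy => hy x hx
  let Λ : AddSubgroup T := S.comap T.subtype.toAddMonoidHom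
  have hspan : Submodule.span ℝ (Λ : Set T) = ⊤ := Submodule.span_span_coe_preimage
  have he0 : e ≠ 0 := by rintro rfl; simp at he
  -- If the orthogonal complement of T is the line of e, the group is of type (i); otherwise it
  -- contains a spacelike u orthogonal to e, and e + βu is isotropic for suitable β. That yields
  -- type (ii) with a = 0.
  by_cases hdim : ∀ w : L, ∃ c : ℝ, c • (⟨e, heT⟩ : L) = w
  · left
    let D : M.EllipticData :=
      { T := T
        L := L
        isCompl := hcompl
        orthogonal := hL
        spacelike := by
          ext c
          refine ⟨fun hc => hsp c hc.1 hc.2, ?_⟩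
          rintro rfl
          exact ⟨T.zero_mem, M.zero_mem_cone⟩
        finrank_L := (finrank_eq_one_iff_of_nonzero' (⟨e, heT⟩ : L)
          fun h0 => he0 (congrArg Subtype.val h0)).mpr hdim
        timelike_L := ⟨e, heT, mem_interior_cone heC he⟩
        Λ := Λ
        lattice := ⟨hΓ.discreteTopology_of_injective (f := Subtype.val) continuous_subtype_val
          Subtype.val_injective fun x hx => hx, hspan⟩ }
    refine ⟨D, ?_⟩
    ext γ
    rw [D.mem_group_iff]
    constructor
    · rintro ⟨x, hx, rfl⟩
      obtain ⟨γ, hγ, h1⟩ := hS' x hx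
      have : AffineEquiv.constVAdd ℝ V (x : V) = γ := by ext v; exact (h1 v).symm
      rwa [this]
    · intro hγ
      obtain ⟨x, hx, h1⟩ := hS γ hγ
      exact ⟨⟨x, Submodule.subset_span hx⟩, hx, by ext v; exact (h1 v).symm⟩
  · right
    push Not at hdim
    obtain ⟨⟨z, hz⟩, hze⟩ := hdim
    obtain ⟨u, hu0, hue, huT⟩ : ∃ u, u ≠ 0 ∧ M.form e u = 0 ∧ ∀ x ∈ T, M.form x u = 0 := by
      refine ⟨z - (M.form e z / M.form e e) • e, fun h0 => ?_, ?_, fun x hx => ?_⟩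
      · exact hze _ (Subtype.ext (sub_eq_zero.mp h0).symm)
      · rw [map_sub, map_smul, smul_eq_mul, div_mul_cancel₀ _ he.ne', sub_self]
      · rw [map_sub, map_smul, hL x hx z hz, heT x hx, smul_zero, sub_zero]
    have hu := M.form_self_neg_of_orthogonal he hue hu0
    obtain ⟨β, hβ⟩ : ∃ β : ℝ, β ^ 2 * M.form u u = -M.form e e := by
      refine ⟨√(-M.form e e / M.form u u), ?_⟩
      rw [Real.sq_sqrt (div_nonneg_of_nonpos (by linarith) hu.le), div_mul_cancel₀ _ hu.ne]
    have hue' : M.form u e = 0 := by rw [M.symm]; exact hue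
    have hiso : M.form (e + β • u) (e + β • u) = 0 := by
      simp only [map_add, map_smul, LinearMap.add_apply, LinearMap.smul_apply, smul_eq_mul, hue,
        hue']
      linear_combination hβ
    have hC : e + β • u ∈ M.cone := by
      rw [M.cone_eq_of_timelike heC he]
      refine ⟨hiso.ge, ?_⟩
      simp only [map_add, map_smul, smul_eq_mul, hue]
      linarith
    have hne : e + β • u ≠ 0 := by
      intro h0
      have : M.form e (e + β • u) = 0 := by rw [h0, map_zero]
      rw [map_add, map_smul, hue, smul_zero, add_zero] at this
      exact he.ne' this
    obtain ⟨c, d, hf⟩ := exists_isNullFrame heC he hC hiso hne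
    have hTN : T ≤ M.transverse (e + β • u) (c • e + d • (e + β • u)) := by
      intro x hx
      rw [mem_transverse, M.symm _ x, M.symm _ x]
      simp only [map_add, map_smul, heT x hx, huT x hx]
      simp
    have hmap : ∀ (x : T) v, M.parabolicMap (e + β • u)
        ((0 : T →ₗ[ℝ] M.transverse (e + β • u) (c • e + d • (e + β • u))) x) x v = x + v := by
      intro x v
      rw [add_comm (x : V) v]
      simp [parabolicMap, nu_apply]
    refine exists_parabolicData hΓ hf hTN 0 (fun x y => by simp) Λ hspan (fun x hx => ?_)
      (fun γ hγ => ?_) fun t => ?_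
    · obtain ⟨γ, hγ, h1⟩ := hS' x hx
      exact ⟨γ, hγ, fun v => (h1 v).trans (hmap x v).symm⟩
    · obtain ⟨x, hx, h1⟩ := hS γ hγ
      exact ⟨⟨x, Submodule.subset_span hx⟩, hx,
        fun v => (h1 v).trans (hmap ⟨x, Submodule.subset_span hx⟩ v).symm⟩
    · rw [smul_zero, add_zero]
      exact Submodule.ker_inclusion _ _ _

omit [FiniteDimensional ℝ V] in
theorem IsFlatGroup.exists_parabolicParam (hΓ : M.IsFlatGroup Γ) (hu : IsUnipotent Γ)
    (hc : M.IsCausal Γ) {v₀ : V} (h₀C : v₀ ∈ M.cone) (hne : v₀ ≠ 0) (h₀ : M.form v₀ v₀ = 0)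
    (hfix : ∀ γ ∈ Γ, γ.linear v₀ = v₀) (hlin : ∃ γ ∈ Γ, (γ.linear : V →ₗ[ℝ] V) ≠ 1) :
    ∃ v₁ S, M.IsParabolicParam Γ v₀ v₁ S := by
  obtain ⟨e, heC, he⟩ := M.exists_timelike
  obtain ⟨a, b, hf⟩ := exists_isNullFrame heC he h₀C h₀ hne
  set v₁ := a • e + b • v₀
  let α : (V ≃ᵃ[ℝ] V) → V := fun γ => M.nproj v₀ v₁ (γ.linear v₁)
  have hα₀ : ∀ γ, M.form v₀ (α γ) = 0 := fun γ => hf.form_nproj₀ _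
  have hα₁ : ∀ γ, M.form v₁ (α γ) = 0 := fun γ => hf.form_nproj₁ _
  have hγlin : ∀ γ ∈ Γ, (γ.linear : V →ₗ[ℝ] V) = M.nu v₀ (α γ) := fun γ hγ =>
    hf.eq_nu (g := γ.linear.toLinearMap) (hΓ.form_eq γ hγ) (hu γ hγ) (hfix γ hγ)
  have happ : ∀ γ ∈ Γ, ∀ v, γ v = M.nu v₀ (α γ) v + γ 0 := fun γ hγ v =>
    apply_eq_of_linear (hγlin γ hγ) v
  have hαmul : ∀ γ ∈ Γ, ∀ δ ∈ Γ, α (γ * δ) = α γ + α δ := by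
    intro γ hγ δ hδ
    have h1 : (γ * δ).linear v₁ = M.nu v₀ (α γ + α δ) v₁ := by
      rw [nu_add h₀ (hα₀ γ) (hα₀ δ), ← hγlin γ hγ, ← hγlin δ hδ]; rfl
    change M.nproj v₀ v₁ ((γ * δ).linear v₁) = _
    rw [h1, hf.nproj_nu (by simp [hα₀]) (by simp [hα₁])]
  -- The square of γ(tα) − tα is affine in t with slope −2ℓ(α,α)ℓ(v₀,γ0). A nonzero slope would make
  -- it vanish at the t below, against causality.
  have hτ1 : ∀ γ ∈ Γ, α γ ≠ 0 → M.form v₀ (γ 0) = 0 := by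
    intro γ hγ hα
    by_contra hσ
    have hq := hf.form_self_neg (hα₀ γ) (hα₁ γ) hα
    have hγ1 : γ ≠ 1 := by
      rintro rfl
      apply hα
      change M.nproj v₀ v₁ v₁ = 0
      rw [nproj_apply, hf.self₁, hf.form_eq]; simp
    set t := M.form (γ 0) (γ 0) / (2 * M.form v₀ (γ 0) * M.form (α γ) (α γ)) with ht
    have h1 := hΓ.form_sub_self_neg hc hγ hγ1 (t • α γ)
    have h2 : γ (t • α γ) - t • α γ = γ 0 - (t * M.form (α γ) (α γ)) • v₀ := by
      rw [happ γ hγ (t • α γ), nu_apply, map_smul, hα₀, map_smul, LinearMap.smul_apply]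
      simp only [smul_eq_mul]
      module
    rw [h2, form_sub_self, form_smul_self, h₀, map_smul, M.symm (γ 0) v₀, smul_eq_mul] at h1
    have h3 : t * (2 * M.form v₀ (γ 0) * M.form (α γ) (α γ)) = M.form (γ 0) (γ 0) := by
      rw [ht, div_mul_cancel₀]
      exact mul_ne_zero (mul_ne_zero two_ne_zero hσ) hq.ne
    linarith
  have hσmul : ∀ γ ∈ Γ, ∀ δ, M.form v₀ ((γ * δ) 0) = M.form v₀ (γ 0) + M.form v₀ (δ 0) := by
    intro γ hγ δ
    change M.form v₀ (γ (δ 0)) = _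
    rw [happ γ hγ (δ 0), map_add, form_nu h₀ (hα₀ γ), add_comm]
  have hτ : ∀ γ ∈ Γ, M.form v₀ (γ 0) = 0 := by
    intro γ hγ
    -- A translation is multiplied by an element with nontrivial linear part, and ℓ(v₀,γ0) is
    -- additive in γ.
    by_cases hα : α γ = 0
    · obtain ⟨δ, hδ, hδ1⟩ := hlin
      have h1 : α δ ≠ 0 := fun h => hδ1 (by rw [hγlin δ hδ, h, nu_zero])
      have h2 := hτ1 (γ * δ) (mul_mem hγ hδ) (by rwa [hαmul γ hγ δ hδ, hα, zero_add])
      rwa [hσmul γ hγ, hτ1 δ hδ h1, add_zero] at h2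
    · exact hτ1 γ hγ hα
  have hτmul : ∀ γ ∈ Γ, ∀ δ ∈ Γ, (γ * δ) 0 = γ 0 + δ 0 - M.form (α γ) (δ 0) • v₀ := by
    intro γ hγ δ hδ
    change γ (δ 0) = _
    rw [happ γ hγ (δ 0), nu_apply, hτ δ hδ, M.symm (δ 0)]
    module
  have hnmul : ∀ γ ∈ Γ, ∀ δ ∈ Γ, M.nproj v₀ v₁ ((γ * δ) 0) =
      M.nproj v₀ v₁ (γ 0) + M.nproj v₀ v₁ (δ 0) := by
    intro γ hγ δ hδ
    have h1 : M.nproj v₀ v₁ v₀ = 0 := by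
      rw [nproj_apply, h₀, hf.swap.form_eq]; simp
    rw [hτmul γ hγ δ hδ, map_sub, map_add, map_smul, h1, smul_zero, sub_zero]
  have hfaith : ∀ γ ∈ Γ, M.nproj v₀ v₁ (γ 0) = 0 → γ = 1 := by
    intro γ hγ h1
    by_contra hγ1
    have h2 := hΓ.form_sub_self_neg hc hγ hγ1 0
    rw [sub_zero] at h2
    exact h2.ne ((hf.nproj_eq_zero_iff (hτ γ hγ)).mp h1)
  -- The N-component of γ0 is additive in γ with trivial kernel, so Γ embeds in a vector group.
  -- Comparing the v₀-parts of γδ0 and δγ0 then gives the symmetry below.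
  have hcomm : ∀ γ ∈ Γ, ∀ δ ∈ Γ, γ * δ = δ * γ := by
    intro γ hγ δ hδ
    have h1 := hnmul (γ * δ * (δ * γ)⁻¹) (mul_mem (mul_mem hγ hδ) (inv_mem (mul_mem hδ hγ)))
      (δ * γ) (mul_mem hδ hγ)
    rw [inv_mul_cancel_right, hnmul γ hγ δ hδ, hnmul δ hδ γ hγ, add_comm, right_eq_add] at h1
    exact mul_inv_eq_one.mp (hfaith _ (mul_mem (mul_mem hγ hδ) (inv_mem (mul_mem hδ hγ))) h1)
  have hsymm : ∀ γ ∈ Γ, ∀ δ ∈ Γ, M.form (α γ) (δ 0) = M.form (γ 0) (α δ) := by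
    intro γ hγ δ hδ
    have h1 := hτmul γ hγ δ hδ
    rw [hcomm γ hγ δ hδ, hτmul δ hδ γ hγ, add_comm (γ 0), sub_right_inj] at h1
    rw [M.symm (γ 0)]
    exact (smul_left_injective ℝ hne h1).symm
  -- The correction along v₀ cancels the quadratic term of `parabolicMap`; by the symmetry it also
  -- makes β additive.
  let β : (V ≃ᵃ[ℝ] V) → V := fun γ => γ 0 + (1 / 2 * M.form (α γ) (γ 0)) • v₀
  have hβ₀ : ∀ γ ∈ Γ, M.form v₀ (β γ) = 0 := fun γ hγ => by simp [β, hτ γ hγ, h₀]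
  have hβα : ∀ γ δ, M.form (α γ) (β δ) = M.form (α γ) (δ 0) := fun γ δ => by
    have : M.form (α γ) v₀ = 0 := by rw [M.symm]; exact hα₀ γ
    simp [β, this]
  have hmap : ∀ γ ∈ Γ, ∀ v, γ v = M.parabolicMap v₀ (α γ) (β γ) v := by
    intro γ hγ v
    rw [happ γ hγ v, parabolicMap, hβα]
    simp [β]
  have hβmul : ∀ γ ∈ Γ, ∀ δ ∈ Γ, β (γ * δ) = β γ + β δ := by
    intro γ hγ δ hδ
    have h1 : ∀ γ, M.form (α γ) v₀ = 0 := fun γ => by rw [M.symm]; exact hα₀ γ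
    have h2 : M.form (α δ) (γ 0) = M.form (α γ) (δ 0) := by
      rw [hsymm δ hδ γ hγ, M.symm]
    simp only [β, hαmul γ hγ δ hδ, hτmul γ hγ δ hδ, map_add, map_sub, map_smul,
      LinearMap.add_apply, h1, h2]
    module
  let Φ : Γ →* Multiplicative (V × V) :=
    MonoidHom.mk' (fun γ => Multiplicative.ofAdd (α γ, β γ)) fun γ δ =>
      congrArg Multiplicative.ofAdd
        (Prod.ext (hαmul γ γ.2 δ δ.2) (hβmul γ γ.2 δ δ.2))
  let S : AddSubgroup (V × V) := Subgroup.toAddSubgroup' Φ.range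
  have hSmem : ∀ p ∈ S, ∃ γ ∈ Γ, (α γ, β γ) = p := by
    rintro _ ⟨γ, rfl⟩
    exact ⟨γ, γ.2, rfl⟩
  refine ⟨v₁, S, hf, ?_, fun γ hγ => ⟨_, ⟨⟨γ, hγ⟩, rfl⟩, hmap γ hγ⟩, ?_, ?_, ?_, ?_⟩
  · intro p hp
    obtain ⟨γ, hγ, rfl⟩ := hSmem p hp
    exact ⟨γ, hγ, hmap γ hγ⟩
  · intro p hp
    obtain ⟨γ, hγ, rfl⟩ := hSmem p hp
    exact hα₀ γ
  · intro p hp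
    obtain ⟨γ, hγ, rfl⟩ := hSmem p hp
    exact hα₁ γ
  · intro p hp
    obtain ⟨γ, hγ, rfl⟩ := hSmem p hp
    exact hβ₀ γ hγ
  · intro p hp q hq
    obtain ⟨γ, hγ, rfl⟩ := hSmem p hp
    obtain ⟨δ, hδ, rfl⟩ := hSmem q hq
    change M.form (α γ) (β δ) = M.form (β γ) (α δ)
    rw [hβα, M.symm (β γ), hβα, hsymm γ hγ δ hδ, M.symm]

omit [FiniteDimensional ℝ V] in
theorem isFiniteCover_refl (Γ : Subgroup (V ≃ᵃ[ℝ] V)) : IsFiniteCover Γ Γ := by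
  have h : FlatQuotient.map (le_refl Γ) = id := by
    ext p
    obtain ⟨v, rfl⟩ := proj_surjective p
    rfl
  refine ⟨le_rfl, ?_, fun p => ?_⟩
  · rw [h]
    have h1 : ∀ p : FlatQuotient Γ, IsEvenlyCovered (id : FlatQuotient Γ → FlatQuotient Γ) p Unit :=
      fun p => ⟨inferInstance, Set.univ, trivial, isOpen_univ, isOpen_univ,
        (Homeomorph.prodPUnit (Set.univ : Set (FlatQuotient Γ))).symm, fun _ => rfl⟩
    exact fun p => (h1 p).to_isEvenlyCovered_preimage
  · rw [h]
    exact Set.finite_singleton p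

end Minkowski

theorem mainTheorem3 {V : Type*} [NormedAddCommGroup V] [NormedSpace ℝ V] [FiniteDimensional ℝ V]
    (M : Minkowski V) :
    (∀ Γ : Subgroup (V ≃ᵃ[ℝ] V), M.IsFlatGroup Γ → Minkowski.IsUnipotent Γ →
      M.IsStrictlyCausal Γ →
      ∃ Γ' : Subgroup (V ≃ᵃ[ℝ] V), IsFiniteCover Γ' Γ ∧
        ((∃ D : M.EllipticData, D.group = Γ') ∨
          ∃ D : M.ParabolicData, D.group = Γ' ∧ D.KerTrivial)) ∧
    (∀ D : M.EllipticData,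
      M.IsFlatGroup D.group ∧ M.IsStrictlyCausal D.group ∧
        Nonempty (FlatQuotient D.group ≃ₜ (D.T ⧸ D.Λ) × (V ⧸ D.T))) ∧
    (∀ D : M.ParabolicData, D.KerTrivial →
      M.IsFlatGroup D.group ∧ M.IsStrictlyCausal D.group ∧
        Nonempty (FlatQuotient D.group ≃ₜ (D.T ⧸ D.Λ) × (V ⧸ D.T))) := by
  refine ⟨fun Γ hΓ hu hc => ⟨Γ, Minkowski.isFiniteCover_refl Γ, ?_⟩,
    fun D => ⟨D.isFlatGroup, D.isStrictlyCausal, D.nonempty_homeomorph⟩,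
    fun D hD => ⟨D.isFlatGroup hD, D.isStrictlyCausal hD, D.nonempty_homeomorph hD⟩⟩
  by_cases hlin : ∀ γ ∈ Γ, (γ.linear : V →ₗ[ℝ] V) = 1
  · exact hΓ.exists_data_of_linear_eq_one hc hlin
  right
  obtain ⟨v₀, h₀C, hne, h₀, hfix⟩ := (hΓ.linear_one_or_exists_fixed hu).resolve_left hlin
  push Not at hlin
  obtain ⟨v₁, S, hS⟩ := hΓ.exists_parabolicParam hu hc.1 h₀C hne h₀ hfix hlin
  exact hS.exists_data hΓ hc
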